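/- All vector spaces are over $\mathbb C$. A *nonlocal vertex algebra* is a vector space $V$ with a linear map $Y(\cdot,x):V\to \mathrm{Hom}(V,V((x)))$ and a vector ${\bf 1}\in V$ such that $Y({\bf 1},x)=1$, $Y(v,x){\bf 1}\in V[[x]]$ with constant term $v$ for $v\in V$, and for all $u,v,w\in V$ there is an integer $l\ge 0$ with $$(x_0+x_2)^lY(u,x_0+x_2)Y(v,x_2)w=(x_0+x_2)^lY(Y(u,x_0)v,x_2)w .$$ A *homomorphism* is a linear map $\psi$ with $\psi({\bf 1})={\bf 1}$ and $\psi(Y(u,x)v)=Y(\psi(u),x)\psi(v)$. A *module* $W$ for $V$ is a vector space with a linear map $Y_W(\cdot,x):V\to\mathrm{Hom}(W,W((x)))$ such that $Y_W({\bf 1},x)=1$ and for all $u,v\in V$, $w\in W$ there is $l\ge 0$ with $(x_0+x_2)^lY_W(u,x_0+x_2)Y_W(v,x_2)w=(x_0+x_2)^lY_W(Y(u,x_0)v,x_2)w$. Here and below, $(x_0+x_2)^n$ and $(x_1-x_2)^n$ are expanded in nonnegative powers of $x_2$. A *vertex bialgebra* is a nonlocal vertex algebra $H$ with a (coassociative,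 counital) coalgebra structure $(\Delta,\varepsilon)$ such that $\Delta:H\to H\otimes H$ and $\varepsilon:H\to\mathbb C$ are homomorphisms of nonlocal vertex algebras, where $Y(a\otimes b,x)(c\otimes d)=Y(a,x)c\otimes Y(b,x)d$ on $H\otimes H$ and $Y(a,x)b=ab$ on $\mathbb C$. Write $\Delta(h)=\sum h_{(1)}\otimes h_{(2)}$. An *$H$-module nonlocal vertex algebra* is a nonlocal vertex algebra $V$ with an $H$-module structure $h\mapsto Y(h,x)$ on $V$ such that for $h\in H$, $u,v\in V$, $$Y(h,x)v\in V\otimes\mathbb C((x)),\qquad Y(h,x){\bf 1}_V=\varepsilon(h){\bf 1}_V,\qquad Y(h,x_1)Y(u,x_2)v=\sum Y(Y(h_{(1)},x_1-x_2)u,x_2)Y(h_{(2)},x_1)v .$$ **Theorem.** Let $H$ be a vertex bialgebra and let $V$ be an $H$-module nonlocal vertex algebra. Let $V\sharp H=V\otimes H$ as a vector space, and define a linear map $Y^\sharp$ by $$Y^\sharp(u\otimes h,x)(v\otimes k)=\sum Y(u,x)Y(h_{(1)},x)v\otimes Y(h_{(2)},x)k\qquad(u,v\in V,\ h,k\in H),$$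 where $Y(u,x)$ is extended $\mathbb C((x))$-linearly to $V\otimes\mathbb C((x))$. Then: 1. $V\sharp H$, with $Y^\sharp$ and vacuum vector ${\bf 1}_V\otimes{\bf 1}_H$, is a nonlocal vertex algebra. 2. $V$ and $H$ are subalgebras of it: $u\mapsto u\otimes{\bf 1}_H$ is an injective homomorphism $V\to V\sharp H$, and $h\mapsto {\bf 1}_V\otimes h$ is a homomorphism $H\to V\sharp H$, injective if $V\ne 0$. 3. For $h\in H$ and $u\in V$, with $h$ and $u$ identified with their images in $V\sharp H$, $$Y^\sharp(h,x_1)Y^\sharp(u,x_2)=\sum Y^\sharp(Y(h_{(1)},x_1-x_2)u,x_2)\,Y^\sharp(h_{(2)},x_1),$$ where, applied to any vector of $V\otimes H$, each coefficient on the right-hand side is a finite sum. -/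

import Mathlib

open scoped TensorProduct

noncomputable section

namespace NonlocalVA

section Laurent

variable {V W K L : Type*} [AddCommGroup V] [Module ℂ V] [AddCommGroup W] [Module ℂ W]
  [AddCommGroup K] [Module ℂ K] [AddCommGroup L] [Module ℂ L]

/-- The space `V((x))` of lower truncated formal Laurent series with coefficients in `V`.
Mathlib's `VertexOperator ℂ V` is `Hom(V, V((x)))`. -/
abbrev Laurent (V : Type*) [AddCommGroup V] [Module ℂ V] : Type _ := HahnModule ℤ ℂ V

/-- The coefficient of `x ^ n` in an element of `V((x))`. -/
def cf (n : ℤ) : Laurent V →ₗ[ℂ] V where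
  toFun a := ((HahnModule.of ℂ).symm a).coeff n
  map_add' _ _ := rfl
  map_smul' _ _ := rfl

theorem cf_ext {a b : Laurent V} (h : ∀ n, cf n a = cf n b) : a = b :=
  HahnModule.ext _ _ (funext h)

theorem exists_cf_eq_zero (a : Laurent V) : ∃ N : ℤ, ∀ n < N, cf n a = 0 := by
  by_cases h0 : (HahnModule.of ℂ).symm a = 0
  · exact ⟨0, fun n _ => congrArg (fun s => HahnSeries.coeff s n) h0⟩
  · exact ⟨((HahnModule.of ℂ).symm a).order, fun n hn =>
      HahnSeries.coeff_eq_zero_of_lt_order hn⟩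

/-- The lower truncated series `∑ f n x ^ n`. -/
def mkLaurent (f : ℤ → V) (hf : ∃ N : ℤ, ∀ n < N, f n = 0) : Laurent V :=
  HahnModule.of ℂ
    { coeff := f
      isPWO_support' := by
        obtain ⟨N, hN⟩ := hf
        refine (BddBelow.isWF ⟨N, fun n hn => ?_⟩).isPWO
        by_contra h
        exact hn (hN n (not_le.mp h)) }

@[simp] theorem cf_mkLaurent (f : ℤ → V) (hf : ∃ N : ℤ, ∀ n < N, f n = 0) (n : ℤ) :
    cf n (mkLaurent f hf) = f n := rfl

/-- The constant series `v` in `V((x))`. -/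
def constLaurent : V →ₗ[ℂ] Laurent V where
  toFun v := mkLaurent (fun n => if n = 0 then v else 0) ⟨0, fun n hn => by simp [hn.ne]⟩
  map_add' u v := cf_ext fun n => by by_cases h : n = 0 <;> simp [h]
  map_smul' c v := cf_ext fun n => by by_cases h : n = 0 <;> simp [h]

theorem cf_constLaurent (v : V) (n : ℤ) :
    cf n (constLaurent v) = if n = 0 then v else 0 := rfl

theorem tensor_support_finite (a : Laurent V) (b : Laurent K) (n : ℤ) :
    (Function.support fun i : ℤ => cf i a ⊗ₜ[ℂ] cf (n - i) b).Finite := by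
  obtain ⟨N, hN⟩ := exists_cf_eq_zero a
  obtain ⟨M, hM⟩ := exists_cf_eq_zero b
  refine (Set.finite_Icc N (n - M)).subset fun i hi => ?_
  constructor
  · by_contra h
    exact hi (by simp [hN i (by omega)])
  · by_contra h
    exact hi (by simp [hM (n - i) (by omega)])

/-- The product `a(x) ⊗ b(x)` in `(V ⊗ K)((x))` of `a(x)` in `V((x))` and `b(x)` in `K((x))`. -/
def laurentTensor : Laurent V →ₗ[ℂ] Laurent K →ₗ[ℂ] Laurent (V ⊗[ℂ] K) :=
  LinearMap.mk₂ ℂ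
    (fun a b => mkLaurent (fun n => ∑ᶠ i : ℤ, cf i a ⊗ₜ[ℂ] cf (n - i) b) (by
      obtain ⟨N, hN⟩ := exists_cf_eq_zero a
      obtain ⟨M, hM⟩ := exists_cf_eq_zero b
      refine ⟨N + M, fun n hn => ?_⟩
      rw [← finsum_zero (α := ℤ)]
      refine finsum_congr fun i => ?_
      rcases lt_or_ge i N with h | h
      · simp [hN i h]
      · simp [hM (n - i) (by omega)]))
    (fun a a' b => cf_ext fun n => by
      simp only [map_add, cf_mkLaurent, TensorProduct.add_tmul]
      exact finsum_add_distrib (tensor_support_finite _ _ _) (tensor_support_finite _ _ _))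
    (fun c a b => cf_ext fun n => by
      simp only [map_smul, cf_mkLaurent, ← TensorProduct.smul_tmul']
      rw [smul_finsum])
    (fun a b b' => cf_ext fun n => by
      simp only [map_add, cf_mkLaurent, TensorProduct.tmul_add]
      exact finsum_add_distrib (tensor_support_finite _ _ _) (tensor_support_finite _ _ _))
    (fun c a b => cf_ext fun n => by
      simp only [map_smul, cf_mkLaurent, TensorProduct.tmul_smul]
      rw [smul_finsum])

theorem cf_laurentTensor (a : Laurent V) (b : Laurent K) (n : ℤ) :
    cf n (laurentTensor a b) = ∑ᶠ i : ℤ, cf i a ⊗ₜ[ℂ] cf (n - i) b := rfl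

/-- For `A(x) : V → W((x))`, the map `V ⊗ ℂ((x)) → W((x))`, `v ⊗ f(x) ↦ f(x) A(x) v`. -/
def extendScalars (A : HVertexOperator ℤ ℂ V W) : V ⊗[ℂ] LaurentSeries ℂ →ₗ[ℂ] Laurent W :=
  TensorProduct.lift (LinearMap.mk₂ ℂ (fun v (f : LaurentSeries ℂ) => f • A v)
    (fun u v f => by rw [map_add, smul_add])
    (fun c v f => by rw [map_smul]; exact (smul_comm c f (A v)).symm)
    (fun v f g => by rw [add_smul])
    (fun c v f => by rw [smul_assoc]))

@[simp] theorem extendScalars_tmul (A : HVertexOperator ℤ ℂ V W) (v : V) (f : LaurentSeries ℂ) :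
    extendScalars A (v ⊗ₜ f) = f • A v := rfl

theorem extendScalars_add (A B : HVertexOperator ℤ ℂ V W) (t : V ⊗[ℂ] LaurentSeries ℂ) :
    extendScalars (A + B) t = extendScalars A t + extendScalars B t := by
  induction t with
  | zero => simp
  | add x y hx hy => rw [map_add, hx, hy, map_add, map_add]; abel
  | tmul v f => simp

theorem extendScalars_smul (c : ℂ) (A : HVertexOperator ℤ ℂ V W)
    (t : V ⊗[ℂ] LaurentSeries ℂ) : extendScalars (c • A) t = c • extendScalars A t := by
  induction t with
  | zero => rw [map_zero, map_zero]; exact (smul_zero c).symm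
  | add x y hx hy => rw [map_add, hx, hy, map_add, smul_add]
  | tmul v f => exact (smul_comm c f (A v)).symm

/-- The natural embedding `V ⊗ ℂ((x)) → V((x))`, `v ⊗ f(x) ↦ f(x) v`. -/
def tensorEmb (V : Type*) [AddCommGroup V] [Module ℂ V] :
    V ⊗[ℂ] LaurentSeries ℂ →ₗ[ℂ] Laurent V :=
  extendScalars constLaurent

theorem cf_tensorEmb_tmul (v : V) (f : LaurentSeries ℂ) (n : ℤ) :
    cf n (tensorEmb V (v ⊗ₜ f)) = f.coeff n • v := by
  have h : cf n (tensorEmb V (v ⊗ₜ f)) =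
      ∑ ij ∈ Finset.VAddAntidiagonal n (Set.VAddAntidiagonal.finite_of_isPWO f.isPWO_support
        ((HahnModule.of ℂ).symm (constLaurent v)).isPWO_support n),
        f.coeff ij.1 • cf ij.2 (constLaurent v) := rfl
  rw [h, Finset.sum_eq_single (n, 0)]
  · simp [cf_constLaurent]
  · rintro ⟨i, k⟩ hik hne
    rw [Finset.mem_vaddAntidiagonal] at hik
    have h2 : i + k = n := hik.2.2
    have h3 : k ≠ 0 := fun hk => hne (by simp [hk, ← h2])
    simp [cf_constLaurent, h3]
  · intro hn
    rw [Finset.mem_vaddAntidiagonal] at hn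
    by_contra hc
    exact hn ⟨fun h0 => hc (by simp [h0]), fun h0 => hc (by
      have : cf 0 (constLaurent v) = 0 := h0
      simp [this]), add_zero n⟩

theorem tensorEmb_injective : Function.Injective (tensorEmb V) := by
  rw [← LinearMap.ker_eq_bot, LinearMap.ker_eq_bot']
  classical
  intro t ht
  let b := Module.Basis.ofVectorSpace ℂ V
  let e := TensorProduct.equivFinsuppOfBasisLeft (N := LaurentSeries ℂ) b
  have key : ∀ (t : V ⊗[ℂ] LaurentSeries ℂ) (n : ℤ) (i : _),
      (e t i).coeff n = b.repr (cf n (tensorEmb V t)) i := by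
    intro t n i
    induction t with
    | zero => simp
    | add x y hx hy => simp [hx, hy]
    | tmul v f =>
      rw [cf_tensorEmb_tmul]
      simp [e, mul_comm]
  refine e.injective ?_
  rw [map_zero]
  ext i n
  rw [key, ht]
  simp

/-- For `A : M → Hom(V, V'((x)))` and `B : N → Hom(K, K'((x)))`, the map
`M ⊗ N → Hom(V ⊗ K, (V' ⊗ K')((x)))`, `m ⊗ n ↦ A(m, x) ⊗ B(n, x)`. -/
def tensorOp {M N V' K' : Type*} [AddCommGroup M] [Module ℂ M] [AddCommGroup N] [Module ℂ N]
    [AddCommGroup V'] [Module ℂ V'] [AddCommGroup K'] [Module ℂ K']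
    (A : M →ₗ[ℂ] HVertexOperator ℤ ℂ V V') (B : N →ₗ[ℂ] HVertexOperator ℤ ℂ K K') :
    M ⊗[ℂ] N →ₗ[ℂ] HVertexOperator ℤ ℂ (V ⊗[ℂ] K) (V' ⊗[ℂ] K') :=
  TensorProduct.lift (LinearMap.mk₂ ℂ
    (fun m n => TensorProduct.lift laurentTensor ∘ₗ TensorProduct.map (A m) (B n))
    (fun m m' n => by rw [map_add, TensorProduct.map_add_left, LinearMap.comp_add])
    (fun c m n => by rw [map_smul, TensorProduct.map_smul_left, LinearMap.comp_smul])
    (fun m n n' => by rw [map_add, TensorProduct.map_add_right, LinearMap.comp_add])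
    (fun c m n => by rw [map_smul, TensorProduct.map_smul_right, LinearMap.comp_smul]))

@[simp] theorem tensorOp_tmul_tmul {M N V' K' : Type*} [AddCommGroup M] [Module ℂ M]
    [AddCommGroup N] [Module ℂ N] [AddCommGroup V'] [Module ℂ V'] [AddCommGroup K'] [Module ℂ K']
    (A : M →ₗ[ℂ] HVertexOperator ℤ ℂ V V') (B : N →ₗ[ℂ] HVertexOperator ℤ ℂ K K')
    (m : M) (n : N) (v : V) (k : K) :
    tensorOp A B (m ⊗ₜ n) (v ⊗ₜ k) = laurentTensor (A m v) (B n k) := rfl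

end Laurent

section Algebra

variable {V W H : Type*} [AddCommGroup V] [Module ℂ V] [AddCommGroup W] [Module ℂ W]
  [AddCommGroup H] [Module ℂ H]

/-- For `F(x₁, x₂) = ∑ F m n x₁ ^ m x₂ ^ n` with `F(x₁, x₂)` in `V[[x₁, x₁⁻¹]]((x₂))`, the
coefficients (of `x₀ ^ i x₂ ^ j`) of `F(x₀ + x₂, x₂)`, where `(x₀ + x₂) ^ m` is expanded in
nonnegative powers of `x₂`; the sum is finite. -/
def substAdd (F : ℤ → ℤ → V) (i j : ℤ) : V :=
  ∑ᶠ k : ℕ, (Ring.choose (i + k) k : ℤ) • F (i + k) (j - k)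

/-- The coefficients (of `x₀ ^ i x₂ ^ j`) of `(x₀ + x₂) ^ l F(x₀, x₂)`. -/
def mulAddPow (l : ℕ) (F : ℤ → ℤ → V) (i j : ℤ) : V :=
  ∑ s ∈ Finset.range (l + 1), l.choose s • F (i - (l - s)) (j - s)

/-- Weak associativity: for all `u, v, w` there is a nonnegative integer `l` with
`(x₀ + x₂) ^ l Y_W(u, x₀ + x₂) Y_W(v, x₂) w = (x₀ + x₂) ^ l Y_W(Y(u, x₀) v, x₂) w`. -/
def WeakAssoc (Y : V →ₗ[ℂ] VertexOperator ℂ V) (YW : V →ₗ[ℂ] VertexOperator ℂ W) : Prop :=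
  ∀ (u v : V) (w : W), ∃ l : ℕ, ∀ i j : ℤ,
    mulAddPow l (substAdd fun m n => cf m (YW u (cf n (YW v w)))) i j =
      mulAddPow l (fun m n => cf n (YW (cf m (Y u v)) w)) i j

/-- `(V, Y, vac)` is a nonlocal vertex algebra. -/
structure IsNonlocalVertexAlgebra (Y : V →ₗ[ℂ] VertexOperator ℂ V) (vac : V) : Prop where
  vacuum : ∀ v : V, Y vac v = constLaurent v
  regular : ∀ (v : V) (n : ℤ), n < 0 → cf n (Y v vac) = 0
  creation : ∀ v : V, cf 0 (Y v vac) = v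
  weak_assoc : WeakAssoc Y Y

/-- `(W, YW)` is a module for the nonlocal vertex algebra `(V, Y, vac)`. -/
structure IsModule (Y : V →ₗ[ℂ] VertexOperator ℂ V) (vac : V)
    (YW : V →ₗ[ℂ] VertexOperator ℂ W) : Prop where
  vacuum : ∀ w : W, YW vac w = constLaurent w
  weak_assoc : WeakAssoc Y YW

/-- `f` is a homomorphism of nonlocal vertex algebras from `(V, Y, vac)` to `(W, Y', vac')`. -/
structure IsHom (Y : V →ₗ[ℂ] VertexOperator ℂ V) (vac : V)
    (Y' : W →ₗ[ℂ] VertexOperator ℂ W) (vac' : W) (f : V →ₗ[ℂ] W) : Prop where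
  map_vac : f vac = vac'
  map_op : ∀ (u v : V) (n : ℤ), f (cf n (Y u v)) = cf n (Y' (f u) (f v))

/-- The vertex operator map `Y(a, x) b = a b` of the nonlocal vertex algebra `ℂ`. -/
def scalarY : ℂ →ₗ[ℂ] VertexOperator ℂ ℂ := (LinearMap.mul ℂ ℂ).compr₂ constLaurent

/-- A nonlocal vertex algebra `(H, YH, vacH)` with a coalgebra structure is a vertex bialgebra:
the comultiplication, into the tensor product nonlocal vertex algebra `H ⊗ H`, and the counit
are homomorphisms of nonlocal vertex algebras. -/
structure IsVertexBialgebra [Coalgebra ℂ H] (YH : H →ₗ[ℂ] VertexOperator ℂ H) (vacH : H) :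
    Prop where
  isNonlocalVertexAlgebra : IsNonlocalVertexAlgebra YH vacH
  comul_hom : IsHom YH vacH (tensorOp YH YH) (vacH ⊗ₜ[ℂ] vacH) Coalgebra.comul
  counit_hom : IsHom YH vacH scalarY 1 Coalgebra.counit

/-- For `Z(·, x₂) : V → Hom(W, W((x₂)))`, `a(x) = ∑ aₙ x ^ n` in `V((x))` and
`w(x) = ∑ wₘ x ^ m` in `W((x))`, the contribution to the coefficient of `x₁ ^ i x₂ ^ j` in
`Z(a(x₁ - x₂), x₂) w(x₁)` of the term `(-1) ^ k (n choose k) x₁ ^ (n - k) x₂ ^ k` of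
`(x₁ - x₂) ^ n`, where `p = (n, k)`. -/
def twistedTerm (Z : V →ₗ[ℂ] VertexOperator ℂ W) (a : Laurent V) (w : Laurent W) (i j : ℤ)
    (p : ℤ × ℕ) : W :=
  ((-1) ^ p.2 * Ring.choose p.1 p.2 : ℤ) • cf (j - p.2) (Z (cf p.1 a) (cf (i - p.1 + p.2) w))

/-- The coefficient of `x₁ ^ i x₂ ^ j` in `Z(a(x₁ - x₂), x₂) w(x₁)`, with `(x₁ - x₂) ^ n`
expanded in nonnegative powers of `x₂`. The sum is finite if `a(x)` lies in `V ⊗ ℂ((x))` and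
`w(x)` in `W ⊗ ℂ((x))`. -/
def twistedCoeff (Z : V →ₗ[ℂ] VertexOperator ℂ W) (a : Laurent V) (w : Laurent W)
    (i j : ℤ) : W :=
  ∑ᶠ p : ℤ × ℕ, twistedTerm Z a w i j p

/-- The nonlocal vertex algebra `(V, Y, vac)` with the map `YVH : H → Hom(V, V((x)))` is an
`H`-module nonlocal vertex algebra. The last field is
`Y(h, x₁) Y(u, x₂) v = ∑ Y(Y(h₁, x₁ - x₂) u, x₂) Y(h₂, x₁) v`, where `Δ h = ∑ h₁ ⊗ h₂`. -/
structure IsModuleNonlocalVertexAlgebra [Coalgebra ℂ H] (YH : H →ₗ[ℂ] VertexOperator ℂ H)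
    (vacH : H) (Y : V →ₗ[ℂ] VertexOperator ℂ V) (vac : V) (YVH : H →ₗ[ℂ] VertexOperator ℂ V) :
    Prop where
  isNonlocalVertexAlgebra : IsNonlocalVertexAlgebra Y vac
  isModule : IsModule YH vacH YVH
  mem_range : ∀ (h : H) (v : V), YVH h v ∈ LinearMap.range (tensorEmb V)
  act_vac : ∀ h : H, YVH h vac = constLaurent (Coalgebra.counit (R := ℂ) h • vac)
  act_op : ∀ (h : H) (u v : V) {ι : Type} (r : Coalgebra.Repr ℂ h ι) (i j : ℤ),
    cf i (YVH h (cf j (Y u v))) =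
      ∑ s ∈ r.index, twistedCoeff Y (YVH (r.left s) u) (YVH (r.right s) v) i j

/-- `Y(h, x) v` as an element of `V ⊗ ℂ((x))`, through the injection
`V ⊗ ℂ((x)) → V((x))`. -/
def liftAction (YVH : H →ₗ[ℂ] VertexOperator ℂ V)
    (hr : ∀ (h : H) (v : V), YVH h v ∈ LinearMap.range (tensorEmb V)) :
    H →ₗ[ℂ] V →ₗ[ℂ] V ⊗[ℂ] LaurentSeries ℂ :=
  LinearMap.mk₂ ℂ
    (fun h v => (LinearEquiv.ofInjective (tensorEmb V) tensorEmb_injective).symm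
      ⟨YVH h v, hr h v⟩)
    (fun h h' v => by
      rw [← map_add]; congr 1; exact Subtype.ext (by simp))
    (fun c h v => by
      rw [← map_smul]; congr 1; exact Subtype.ext (by simp))
    (fun h v v' => by
      rw [← map_add]; congr 1; exact Subtype.ext (by simp))
    (fun c h v => by
      rw [← map_smul]; congr 1; exact Subtype.ext (by simp))

theorem tensorEmb_liftAction (YVH : H →ₗ[ℂ] VertexOperator ℂ V)
    (hr : ∀ (h : H) (v : V), YVH h v ∈ LinearMap.range (tensorEmb V)) (h : H) (v : V) :
    tensorEmb V (liftAction YVH hr h v) = YVH h v :=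
  congrArg Subtype.val
    ((LinearEquiv.ofInjective (tensorEmb V) tensorEmb_injective).apply_symm_apply
      ⟨YVH h v, hr h v⟩)

/-- The map `h ↦ Y(u, x) Y(h, x)` from `H` to `Hom(V, V((x)))`; here `Y(u, x)` is extended
`ℂ((x))`-linearly to `V ⊗ ℂ((x))`. -/
def compAction (Y : V →ₗ[ℂ] VertexOperator ℂ V) (YVH : H →ₗ[ℂ] VertexOperator ℂ V)
    (hr : ∀ (h : H) (v : V), YVH h v ∈ LinearMap.range (tensorEmb V)) (u : V) :
    H →ₗ[ℂ] VertexOperator ℂ V :=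
  (liftAction YVH hr).compr₂ (extendScalars (Y u))

theorem tensorOp_compAction_add (Y : V →ₗ[ℂ] VertexOperator ℂ V)
    (YVH : H →ₗ[ℂ] VertexOperator ℂ V)
    (hr : ∀ (h : H) (v : V), YVH h v ∈ LinearMap.range (tensorEmb V))
    (YH : H →ₗ[ℂ] VertexOperator ℂ H) (u u' : V) (t : H ⊗[ℂ] H) :
    tensorOp (compAction Y YVH hr (u + u')) YH t =
      tensorOp (compAction Y YVH hr u) YH t + tensorOp (compAction Y YVH hr u') YH t := by
  have hE : compAction Y YVH hr (u + u') = compAction Y YVH hr u + compAction Y YVH hr u' :=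
    LinearMap.ext fun g => LinearMap.ext fun v => by
      simp [compAction, extendScalars_add]
  induction t with
  | zero => simp
  | add x y hx hy => rw [map_add, hx, hy, map_add, map_add]; abel
  | tmul g g' => exact TensorProduct.ext' fun v k => by simp [hE]

theorem tensorOp_compAction_smul (Y : V →ₗ[ℂ] VertexOperator ℂ V)
    (YVH : H →ₗ[ℂ] VertexOperator ℂ V)
    (hr : ∀ (h : H) (v : V), YVH h v ∈ LinearMap.range (tensorEmb V))
    (YH : H →ₗ[ℂ] VertexOperator ℂ H) (c : ℂ) (u : V) (t : H ⊗[ℂ] H) :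
    tensorOp (compAction Y YVH hr (c • u)) YH t =
      c • tensorOp (compAction Y YVH hr u) YH t := by
  have hE : compAction Y YVH hr (c • u) = c • compAction Y YVH hr u :=
    LinearMap.ext fun g => LinearMap.ext fun v => by
      simp [compAction, extendScalars_smul]
  induction t with
  | zero => simp
  | add x y hx hy => rw [map_add, hx, hy, map_add, smul_add]
  | tmul g g' => exact TensorProduct.ext' fun v k => by simp [hE]

/-- The vertex operator map of the smash product:
`Y♯(u ⊗ h, x) (v ⊗ k) = ∑ Y(u, x) Y(h₁, x) v ⊗ Y(h₂, x) k`, where `Δ h = ∑ h₁ ⊗ h₂`. -/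
def smashY [Coalgebra ℂ H] (Y : V →ₗ[ℂ] VertexOperator ℂ V) (YH : H →ₗ[ℂ] VertexOperator ℂ H)
    (YVH : H →ₗ[ℂ] VertexOperator ℂ V)
    (hr : ∀ (h : H) (v : V), YVH h v ∈ LinearMap.range (tensorEmb V)) :
    V ⊗[ℂ] H →ₗ[ℂ] VertexOperator ℂ (V ⊗[ℂ] H) :=
  TensorProduct.lift (LinearMap.mk₂ ℂ
    (fun u h => tensorOp (compAction Y YVH hr u) YH (Coalgebra.comul h))
    (fun u u' h => tensorOp_compAction_add Y YVH hr YH u u' _)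
    (fun c u h => tensorOp_compAction_smul Y YVH hr YH c u _)
    (fun u h h' => by rw [map_add, map_add])
    (fun c u h => by rw [map_smul, map_smul]))

theorem smashY_tmul_tmul [Coalgebra ℂ H] (Y : V →ₗ[ℂ] VertexOperator ℂ V)
    (YH : H →ₗ[ℂ] VertexOperator ℂ H) (YVH : H →ₗ[ℂ] VertexOperator ℂ V)
    (hr : ∀ (h : H) (v : V), YVH h v ∈ LinearMap.range (tensorEmb V)) (u v : V) (h k : H)
    {ι : Type*} (r : Coalgebra.Repr ℂ h ι) :
    smashY Y YH YVH hr (u ⊗ₜ h) (v ⊗ₜ k) = ∑ s ∈ r.index,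
      laurentTensor (extendScalars (Y u) (liftAction YVH hr (r.left s) v))
        (YH (r.right s) k) := by
  have h1 : smashY Y YH YVH hr (u ⊗ₜ h) =
    tensorOp (compAction Y YVH hr u) YH (Coalgebra.comul h) := rfl
  rw [h1, ← r.eq, map_sum, LinearMap.sum_apply]
  rfl

end Algebra

end NonlocalVA

end

open NonlocalVA

noncomputable section

namespace NonlocalVA

/-! The hard point is weak associativity of `Y♯`. Call `(A(x₁, x₂), B(x₀, x₂))` compatible if `A ∈
V((x₁))((x₂))`, `B ∈ V((x₂))((x₀))`, and `A(x₀ + x₂, x₂)` and `B(x₀, x₂)` become equal after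
multiplication by some power of `x₀ + x₂`. Weak associativity says exactly that product and iterate
of vertex operators form a compatible pair. Two facts make these pairs a calculus. They are closed
under products (`conv_mem_compatPair`), since the substitution `x₁ = x₀ + x₂` is multiplicative
(`substAdd_conv`). And `A` determines `B` (`compatPair.snd_eq`), since multiplication by `x₀ + x₂`
is injective on `V((x₂))((x₀))`.

The scalar pairs are `(f(x₁), f(x₂ + x₀))`, `(f(x₂), f(x₂))` and `(f(x₁ - x₂), f(x₀))`. Because
`Y(h, x)v` lies in `V ⊗ ℂ((x))`, multiplying them with the pair coming from weak associativity of
`V` gives a compatible pair whose components are `Y(u, x₁) Y(Y(g, x₁ - x₂)v, x₂) Y(h, x₁) t(x₂)` and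
`Y(Y(u, x₀)Y(g, x₀)v, x₂) Y(h, x₂ + x₀) t(x₂)`. Its tensor product with the pair of `h'` and `k` in
`H` depends linearly on `g ⊗ h ⊗ h'` and is `smashPair`.

With `t(x) = Y(k₁, x)w` and the second leg `k₂` of `Δk`, the module algebra identity shows that the
product `Y♯(u ⊗ h, x₁)Y♯(v ⊗ k, x₂)(w ⊗ m)` is the first component at `(Δ ⊗ 1)Δh` (`smashPair_fst`).
The iterate is the second component at `(1 ⊗ Δ)Δh` (`smashPair_snd`): `Δ` is a homomorphism, and
`Y(Y(h, x₀)k, x₂)w = Y(h, x₂ + x₀)Y(k, x₂)w` holds with no power of `x₀ + x₂` at all, by uniqueness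
of second components (`liftAction_cf`). Coassociativity identifies the two elements, so both sides
belong to one compatible pair.

The vacuum axioms and the embeddings follow from the unit and counit identities. The twisted
commutation relation is the module algebra identity tensored with `H`, again compared through
coassociativity; membership in `V ⊗ ℂ((x))` gives the uniform truncation that makes its sums finite.
-/

theorem finsum_eq_finsum_of_injective {α β M : Type*} [AddCommMonoid M] {g : α → β}
    (hg : Function.Injective g) {f : β → M} (hs : Function.support f ⊆ Set.range g) :
    ∑ᶠ b, f b = ∑ᶠ a, f (g a) := by
  rw [← finsum_mem_range hg, ← finsum_mem_univ]
  exact finsum_mem_inter_support_eq f _ _ (by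
    rw [Set.univ_inter, Set.inter_eq_self_of_subset_right hs])

/-! ### Multiplication by `x₀ + x₂` and the iterated Laurent spaces. -/

section TwoVariable

variable {V W K U : Type*} [AddCommGroup V] [Module ℂ V] [AddCommGroup W] [Module ℂ W]
  [AddCommGroup K] [Module ℂ K] [AddCommGroup U] [Module ℂ U]

/-- Multiplication by `x₀ + x₂` on formal series in two variables. -/
def mulAdd : Module.End ℂ (ℤ → ℤ → V) where
  toFun F i j := F (i - 1) j + F i (j - 1)
  map_add' F G := by ext i j; simp only [Pi.add_apply]; abel
  map_smul' c F := by ext i j; simp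

@[simp] theorem mulAdd_apply (F : ℤ → ℤ → V) (i j : ℤ) :
    mulAdd F i j = F (i - 1) j + F i (j - 1) := rfl

/-- Multiplication by the first variable. -/
def shiftFst : Module.End ℂ (ℤ → ℤ → V) where
  toFun F i j := F (i - 1) j
  map_add' _ _ := rfl
  map_smul' _ _ := rfl

/-- Multiplication by the second variable. -/
def shiftSnd : Module.End ℂ (ℤ → ℤ → V) where
  toFun F i j := F i (j - 1)
  map_add' _ _ := rfl
  map_smul' _ _ := rfl

theorem shiftFst_pow_apply (n : ℕ) (F : ℤ → ℤ → V) (i j : ℤ) :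
    (shiftFst ^ n) F i j = F (i - n) j := by
  induction n generalizing i with
  | zero => simp
  | succ n ih =>
    rw [pow_succ', Module.End.mul_apply]
    change (shiftFst ^ n) F (i - 1) j = _
    rw [ih]
    congr 1; push_cast; ring

theorem shiftSnd_pow_apply (n : ℕ) (F : ℤ → ℤ → V) (i j : ℤ) :
    (shiftSnd ^ n) F i j = F i (j - n) := by
  induction n generalizing j with
  | zero => simp
  | succ n ih =>
    rw [pow_succ', Module.End.mul_apply]
    change (shiftSnd ^ n) F i (j - 1) = _
    rw [ih]
    congr 1; push_cast; ring

/-- The binomial theorem for the commuting shifts by `x₀` and `x₂`; it lets powers of `x₀ + x₂` be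
handled by iteration. -/
theorem mulAddPow_eq (l : ℕ) (F : ℤ → ℤ → V) : mulAddPow l F = (mulAdd ^ l) F := by
  have h : (mulAdd : Module.End ℂ (ℤ → ℤ → V)) = shiftSnd + shiftFst := by
    ext F i j; simp [shiftFst, shiftSnd, add_comm]
  have hc : Commute (shiftSnd : Module.End ℂ (ℤ → ℤ → V)) shiftFst := by
    ext F i j; rfl
  ext i j
  rw [h, hc.add_pow, LinearMap.sum_apply, Finset.sum_apply, Finset.sum_apply, mulAddPow]
  refine Finset.sum_congr rfl fun s hs => ?_
  have hs' : s ≤ l := Nat.lt_succ_iff.mp (Finset.mem_range.mp hs)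
  rw [← nsmul_eq_mul', LinearMap.smul_apply, Module.End.mul_apply]
  simp only [Pi.smul_apply]
  rw [shiftSnd_pow_apply, shiftFst_pow_apply, Nat.cast_sub hs']

/-- The space `V((x₁))((x₂))`. -/
def iterLaurent (V : Type*) [AddCommGroup V] [Module ℂ V] : Submodule ℂ (ℤ → ℤ → V) where
  carrier := {F | (∃ N : ℤ, ∀ j < N, ∀ i, F i j = 0) ∧ ∀ j, ∃ M : ℤ, ∀ i < M, F i j = 0}
  zero_mem' := ⟨⟨0, fun _ _ _ => rfl⟩, fun _ => ⟨0, fun _ _ => rfl⟩⟩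
  add_mem' := by
    rintro F G ⟨⟨N, hN⟩, hF⟩ ⟨⟨N', hN'⟩, hG⟩
    refine ⟨⟨min N N', fun j hj i => ?_⟩, fun j => ?_⟩
    · simp [hN j (lt_of_lt_of_le hj (min_le_left _ _)) i,
        hN' j (lt_of_lt_of_le hj (min_le_right _ _)) i]
    · obtain ⟨M, hM⟩ := hF j
      obtain ⟨M', hM'⟩ := hG j
      refine ⟨min M M', fun i hi => ?_⟩
      simp [hM i (lt_of_lt_of_le hi (min_le_left _ _)),
        hM' i (lt_of_lt_of_le hi (min_le_right _ _))]
  smul_mem' := by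
    rintro c F ⟨⟨N, hN⟩, hF⟩
    refine ⟨⟨N, fun j hj i => by simp [hN j hj i]⟩, fun j => ?_⟩
    obtain ⟨M, hM⟩ := hF j
    exact ⟨M, fun i hi => by simp [hM i hi]⟩

/-- Exchange of the two variables. -/
def swapVar : (ℤ → ℤ → V) →ₗ[ℂ] (ℤ → ℤ → V) where
  toFun F i j := F j i
  map_add' _ _ := rfl
  map_smul' _ _ := rfl

@[simp] theorem swapVar_apply (F : ℤ → ℤ → V) (i j : ℤ) : swapVar F i j = F j i := rfl

/-- The space `V((x₂))((x₁))`. -/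
def iterLaurentSwap (V : Type*) [AddCommGroup V] [Module ℂ V] : Submodule ℂ (ℤ → ℤ → V) :=
  (iterLaurent V).comap swapVar

theorem mulAdd_mem {F : ℤ → ℤ → V} (hF : F ∈ iterLaurent V) : mulAdd F ∈ iterLaurent V := by
  obtain ⟨⟨N, hN⟩, h⟩ := hF
  refine ⟨⟨N, fun j hj i => ?_⟩, fun j => ?_⟩
  · simp [hN j hj, hN (j - 1) (by omega)]
  · obtain ⟨M, hM⟩ := h j
    obtain ⟨M', hM'⟩ := h (j - 1)
    refine ⟨min M M', fun i hi => ?_⟩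
    have h1 := lt_of_lt_of_le hi (min_le_left _ _)
    have h2 := lt_of_lt_of_le hi (min_le_right _ _)
    simp [hM (i - 1) (by omega), hM' i h2]

theorem swapVar_mulAdd (F : ℤ → ℤ → V) : swapVar (mulAdd F) = mulAdd (swapVar F) := by
  ext i j; simp [add_comm]

theorem mulAdd_mem_swap {F : ℤ → ℤ → V} (hF : F ∈ iterLaurentSwap V) :
    mulAdd F ∈ iterLaurentSwap V := by
  change swapVar (mulAdd F) ∈ iterLaurent V
  rw [swapVar_mulAdd]
  exact mulAdd_mem hF

theorem mulAdd_pow_mem {F : ℤ → ℤ → V} (hF : F ∈ iterLaurent V) (l : ℕ) :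
    (mulAdd ^ l) F ∈ iterLaurent V := by
  induction l with
  | zero => simpa using hF
  | succ l ih => rw [pow_succ', Module.End.mul_apply]; exact mulAdd_mem ih

theorem mulAdd_pow_mem_swap {F : ℤ → ℤ → V} (hF : F ∈ iterLaurentSwap V) (l : ℕ) :
    (mulAdd ^ l) F ∈ iterLaurentSwap V := by
  induction l with
  | zero => simpa using hF
  | succ l ih => rw [pow_succ', Module.End.mul_apply]; exact mulAdd_mem_swap ih

/-- The powers of `x₀` are bounded below uniformly, and in the lowest one `x₀ + x₂` acts as
multiplication by `x₂`, which kills nothing. Vanishing therefore propagates upward in the exponent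
of `x₀`. -/
theorem mulAdd_pow_injective {F : ℤ → ℤ → V} (hF : F ∈ iterLaurentSwap V) (l : ℕ)
    (h : (mulAdd ^ l) F = 0) : F = 0 := by
  induction l with
  | zero => simpa using h
  | succ l ih =>
    refine ih ?_
    rw [pow_succ', Module.End.mul_apply] at h
    obtain ⟨⟨N, hN⟩, -⟩ := mulAdd_pow_mem_swap hF l
    set G := (mulAdd ^ l) F
    have key : ∀ n : ℕ, ∀ i < N + n, ∀ j, G i j = 0 := by
      intro n
      induction n with
      | zero => intro i hi j; exact hN i (by simpa using hi) j
      | succ n ihn =>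
        intro i hi j
        -- The coefficient at `(i, j + 1)` is `G (i - 1) (j + 1) + G i j`, and its first term is
        -- already known to vanish.
        have h1 : mulAdd G i (j + 1) = 0 := by rw [h]; rfl
        rw [mulAdd_apply, ihn (i - 1) (by push_cast at hi; omega), zero_add,
          add_sub_cancel_right] at h1
        exact h1
    ext i j
    exact key (i - N + 1).toNat i (by omega) j

/-! ### Products of two-variable series. -/

/-- Two series are convolvable if each coefficient of their product is a finite sum. -/
def Convolvable {V K : Type*} [AddCommGroup V] [AddCommGroup K] (F : ℤ → ℤ → V)
    (G : ℤ → ℤ → K) : Prop :=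
  ∀ i j : ℤ, {p : ℤ × ℤ | F p.1 p.2 ≠ 0 ∧ G (i - p.1) (j - p.2) ≠ 0}.Finite

/-- The exponent of `x₂` is bounded below in both factors uniformly, so only finitely many of its
splittings contribute; for each of these the exponent of `x₁` is bounded on both sides. -/
theorem convolvable_of_mem {F : ℤ → ℤ → V} {G : ℤ → ℤ → K} (hF : F ∈ iterLaurent V)
    (hG : G ∈ iterLaurent K) : Convolvable F G := by
  intro i j
  obtain ⟨⟨N, hN⟩, hF⟩ := hF
  obtain ⟨⟨N', hN'⟩, hG⟩ := hG
  choose M hM using hF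
  choose M' hM' using hG
  refine ((Set.finite_Icc N (j - N')).biUnion fun b _ =>
    (Set.finite_Icc (M b) (i - M' (j - b))).image fun a => (a, b)).subset ?_
  rintro ⟨a, b⟩ ⟨h1, h2⟩
  simp only [Set.mem_iUnion]
  refine ⟨b, ⟨?_, ?_⟩, a, ⟨?_, ?_⟩, rfl⟩ <;> by_contra hc
  · exact h1 (hN b (by omega) a)
  · exact h2 (hN' (j - b) (by omega) _)
  · exact h1 (hM b a (by omega))
  · exact h2 (hM' (j - b) _ (by omega))

theorem Convolvable.swap {F : ℤ → ℤ → V} {G : ℤ → ℤ → K} (h : Convolvable F G) :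
    Convolvable (swapVar F) (swapVar G) := fun i j =>
  ((h j i).preimage Prod.swap_injective.injOn).subset fun _ hp => hp

theorem convolvable_of_mem_swap {F : ℤ → ℤ → V} {G : ℤ → ℤ → K} (hF : F ∈ iterLaurentSwap V)
    (hG : G ∈ iterLaurentSwap K) : Convolvable F G :=
  (convolvable_of_mem (F := swapVar F) (G := swapVar G) hF hG).swap

theorem Convolvable.symm {V K : Type*} [AddCommGroup V] [AddCommGroup K] {F : ℤ → ℤ → V}
    {G : ℤ → ℤ → K} (h : Convolvable F G) :
    Convolvable G F := fun i j =>
  ((h i j).preimage (f := fun p : ℤ × ℤ => (i - p.1, j - p.2)) (by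
    rintro ⟨a, b⟩ - ⟨c, d⟩ - h
    simpa using h)).subset fun p hp => ⟨hp.2, by simpa using hp.1⟩

/-- The product of two formal series with respect to a bilinear map of the coefficients. -/
def conv (B : V →ₗ[ℂ] K →ₗ[ℂ] U) (F : ℤ → ℤ → V) (G : ℤ → ℤ → K) (i j : ℤ) : U :=
  ∑ᶠ p : ℤ × ℤ, B (F p.1 p.2) (G (i - p.1) (j - p.2))

variable (B : V →ₗ[ℂ] K →ₗ[ℂ] U)

theorem Convolvable.finite_support {F : ℤ → ℤ → V} {G : ℤ → ℤ → K} (h : Convolvable F G)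
    (i j : ℤ) :
    (Function.support fun p : ℤ × ℤ => B (F p.1 p.2) (G (i - p.1) (j - p.2))).Finite :=
  (h i j).subset fun p hp => ⟨fun h0 => hp (by simp [h0]), fun h0 => hp (by simp [h0])⟩

theorem conv_flip (F : ℤ → ℤ → V) (G : ℤ → ℤ → K) : conv B.flip G F = conv B F G := by
  ext i j
  let e : ℤ × ℤ ≃ ℤ × ℤ := (Equiv.subLeft i).prodCongr (Equiv.subLeft j)
  rw [conv, conv, ← finsum_comp_equiv e]
  exact finsum_congr fun p => by simp [e]

theorem conv_swapVar (F : ℤ → ℤ → V) (G : ℤ → ℤ → K) :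
    conv B (swapVar F) (swapVar G) = swapVar (conv B F G) := by
  ext i j
  rw [swapVar_apply, conv, conv, ← finsum_comp_equiv (Equiv.prodComm ℤ ℤ)]
  rfl

variable {B}

theorem conv_add_right {F : ℤ → ℤ → V} {G G' : ℤ → ℤ → K} (h : Convolvable F G)
    (h' : Convolvable F G') : conv B F (G + G') = conv B F G + conv B F G' := by
  ext i j
  simp only [conv, Pi.add_apply, map_add]
  exact finsum_add_distrib (h.finite_support B i j) (h'.finite_support B i j)

theorem conv_add_left {F F' : ℤ → ℤ → V} {G : ℤ → ℤ → K} (h : Convolvable F G)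
    (h' : Convolvable F' G) : conv B (F + F') G = conv B F G + conv B F' G := by
  simp only [← conv_flip B]
  exact conv_add_right h.symm h'.symm

theorem conv_smul_right (c : ℂ) (F : ℤ → ℤ → V) (G : ℤ → ℤ → K) :
    conv B F (c • G) = c • conv B F G := by
  ext i j
  simp only [conv, Pi.smul_apply, map_smul]
  rw [smul_finsum]

theorem conv_smul_left (c : ℂ) (F : ℤ → ℤ → V) (G : ℤ → ℤ → K) :
    conv B (c • F) G = c • conv B F G := by
  simp only [← conv_flip B, conv_smul_right]

theorem conv_zero_left (G : ℤ → ℤ → K) : conv B (0 : ℤ → ℤ → V) G = 0 := by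
  ext i j; simp [conv]

theorem mulAdd_conv_right {F : ℤ → ℤ → V} {G : ℤ → ℤ → K} (h : Convolvable F G) :
    mulAdd (conv B F G) = conv B F (mulAdd G) := by
  ext i j
  simp only [mulAdd_apply, conv, map_add]
  rw [finsum_add_distrib]
  · simp only [sub_right_comm]
  · have := h.finite_support B (i - 1) j
    simp only [sub_right_comm] at this
    exact this
  · have := h.finite_support B i (j - 1)
    simp only [sub_right_comm] at this
    exact this

theorem conv_mem {F : ℤ → ℤ → V} {G : ℤ → ℤ → K} (hF : F ∈ iterLaurent V)
    (hG : G ∈ iterLaurent K) : conv B F G ∈ iterLaurent U := by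
  obtain ⟨⟨N, hN⟩, hF⟩ := hF
  obtain ⟨⟨N', hN'⟩, hG⟩ := hG
  refine ⟨⟨N + N', fun j hj i => ?_⟩, fun j => ?_⟩
  · refine (finsum_congr fun p => ?_).trans finsum_zero
    rcases lt_or_ge p.2 N with h | h
    · simp [hN p.2 h]
    · simp [hN' (j - p.2) (by omega)]
  · choose M hM using hF
    choose M' hM' using hG
    obtain ⟨m, hm⟩ := ((Set.finite_Icc N (j - N')).image
      fun b => M b + M' (j - b)).bddBelow
    refine ⟨m, fun i hi => (finsum_congr fun p => ?_).trans finsum_zero⟩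
    rcases lt_or_ge p.2 N with h | h
    · simp [hN p.2 h]
    rcases lt_or_ge (j - p.2) N' with h' | h'
    · simp [hN' (j - p.2) h']
    have h3 : m ≤ M p.2 + M' (j - p.2) := hm ⟨p.2, ⟨h, by omega⟩, rfl⟩
    rcases lt_or_ge p.1 (M p.2) with h4 | h4
    · simp [hM p.2 p.1 h4]
    · simp [hM' (j - p.2) (i - p.1) (by omega)]

theorem conv_mem_swap {F : ℤ → ℤ → V} {G : ℤ → ℤ → K} (hF : F ∈ iterLaurentSwap V)
    (hG : G ∈ iterLaurentSwap K) : conv B F G ∈ iterLaurentSwap U := by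
  change swapVar (conv B F G) ∈ iterLaurent U
  rw [← conv_swapVar]
  exact conv_mem hF hG

theorem mulAdd_pow_conv_right {F : ℤ → ℤ → V} {G : ℤ → ℤ → K}
    (h : ∀ l, Convolvable F ((mulAdd ^ l) G)) (l : ℕ) :
    (mulAdd ^ l) (conv B F G) = conv B F ((mulAdd ^ l) G) := by
  induction l with
  | zero => simp
  | succ l ih =>
    rw [pow_succ', Module.End.mul_apply, ih, mulAdd_conv_right (h l), pow_succ',
      Module.End.mul_apply]

/-- The clearing powers of two compatible pairs can be distributed over the two factors. The left
factor reduces to the right one by flipping the bilinear map. -/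
theorem mulAdd_pow_conv {F : ℤ → ℤ → V} {G : ℤ → ℤ → K}
    (h : ∀ l l', Convolvable ((mulAdd ^ l) F) ((mulAdd ^ l') G)) (l l' : ℕ) :
    (mulAdd ^ (l + l')) (conv B F G) = conv B ((mulAdd ^ l) F) ((mulAdd ^ l') G) := by
  rw [pow_add, Module.End.mul_apply, mulAdd_pow_conv_right (fun n => by simpa using h 0 n),
    ← conv_flip,
    mulAdd_pow_conv_right (fun n => (h n l').symm), conv_flip]

theorem conv_sum_left {ι : Type*} (s : Finset ι) {F : ι → ℤ → ℤ → V} {G : ℤ → ℤ → K}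
    (hF : ∀ a, F a ∈ iterLaurent V) (hG : G ∈ iterLaurent K) :
    conv B (∑ a ∈ s, F a) G = ∑ a ∈ s, conv B (F a) G := by
  classical
  induction s using Finset.induction_on with
  | empty => simp [conv_zero_left]
  | insert a s ha ih =>
    rw [Finset.sum_insert ha, Finset.sum_insert ha, conv_add_left (convolvable_of_mem (hF a) hG)
      (convolvable_of_mem (Submodule.sum_mem _ fun a _ => hF a) hG), ih]

theorem conv_sum_right {ι : Type*} (s : Finset ι) {F : ℤ → ℤ → V} {G : ι → ℤ → ℤ → K}
    (hF : F ∈ iterLaurent V) (hG : ∀ a, G a ∈ iterLaurent K) :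
    conv B F (∑ a ∈ s, G a) = ∑ a ∈ s, conv B F (G a) := by
  simp only [← conv_flip B]
  exact conv_sum_left s hG hF

/-! ### The substitution `x₁ = x₀ + x₂`. -/

/-- The term `x₂ ^ k ∂ ^ k / k!` of the expansion of `F(x₀ + x₂, x₂)` in powers of `x₂`. -/
def taylorTerm (k : ℕ) : (ℤ → ℤ → V) →ₗ[ℂ] (ℤ → ℤ → V) where
  toFun F i j := (Ring.choose (i + k) k : ℤ) • F (i + k) (j - k)
  map_add' F G := by ext i j; simp
  map_smul' c F := by ext i j; simp only [Pi.smul_apply, RingHom.id_apply]; rw [smul_comm]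

theorem taylorTerm_apply (k : ℕ) (F : ℤ → ℤ → V) (i j : ℤ) :
    taylorTerm k F i j = (Ring.choose (i + k) k : ℤ) • F (i + k) (j - k) := rfl

theorem taylorTerm_eq_zero {F : ℤ → ℤ → V} {N : ℤ} (hN : ∀ j < N, ∀ i, F i j = 0) {k : ℕ}
    {j : ℤ} (h : j < N + k) (i : ℤ) : taylorTerm k F i j = 0 := by
  rw [taylorTerm_apply, hN _ (by omega), smul_zero]

theorem taylorTerm_mem {F : ℤ → ℤ → V} (hF : F ∈ iterLaurent V) (k : ℕ) :
    taylorTerm k F ∈ iterLaurent V := by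
  obtain ⟨⟨N, hN⟩, hF⟩ := hF
  refine ⟨⟨N, fun j hj i => taylorTerm_eq_zero hN (by omega) i⟩, fun j => ?_⟩
  obtain ⟨M, hM⟩ := hF (j - k)
  exact ⟨M - k, fun i hi => by rw [taylorTerm_apply, hM _ (by omega), smul_zero]⟩

theorem substAdd_eq_sum {F : ℤ → ℤ → V} {N : ℤ} (hN : ∀ j < N, ∀ i, F i j = 0) {n : ℕ} {j : ℤ}
    (hj : j < N + n) (i : ℤ) :
    substAdd F i j = ∑ k ∈ Finset.range n, taylorTerm k F i j := by
  refine finsum_eq_sum_of_support_subset _ fun k hk => ?_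
  simp only [Finset.coe_range, Set.mem_Iio]
  by_contra hc
  exact hk (taylorTerm_eq_zero hN (by omega) i)

theorem substAdd_mem {F : ℤ → ℤ → V} (hF : F ∈ iterLaurent V) : substAdd F ∈ iterLaurent V := by
  have hF' := hF
  obtain ⟨⟨N, hN⟩, hF⟩ := hF
  refine ⟨⟨N, fun j hj i => ?_⟩, fun j => ?_⟩
  · rw [substAdd_eq_sum hN (n := 0) (by simpa using hj)]; rfl
  · have h : ∑ k ∈ Finset.range (j - N + 1).toNat, taylorTerm k F ∈ iterLaurent V :=
      Submodule.sum_mem _ fun k _ => taylorTerm_mem hF' k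
    obtain ⟨M, hM⟩ := h.2 j
    refine ⟨M, fun i hi => ?_⟩
    rw [substAdd_eq_sum hN (n := (j - N + 1).toNat) (by omega), ← hM i hi]
    simp only [Finset.sum_apply]

theorem substAdd_add {F G : ℤ → ℤ → V} (hF : F ∈ iterLaurent V) (hG : G ∈ iterLaurent V) :
    substAdd (F + G) = substAdd F + substAdd G := by
  obtain ⟨⟨N, hN⟩, -⟩ := hF
  obtain ⟨⟨N', hN'⟩, -⟩ := hG
  ext i j
  have h1 : ∀ j < min N N', ∀ i, F i j = 0 :=
    fun j hj i => hN j (lt_of_lt_of_le hj (min_le_left _ _)) i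
  have h2 : ∀ j < min N N', ∀ i, G i j = 0 :=
    fun j hj i => hN' j (lt_of_lt_of_le hj (min_le_right _ _)) i
  have hj : j < min N N' + (j - min N N' + 1).toNat := by omega
  rw [Pi.add_apply, Pi.add_apply, substAdd_eq_sum h1 hj, substAdd_eq_sum h2 hj,
    substAdd_eq_sum (fun j hj i => by simp [h1 j hj i, h2 j hj i]) hj, ← Finset.sum_add_distrib]
  simp only [map_add, Pi.add_apply]

theorem substAdd_smul (c : ℂ) (F : ℤ → ℤ → V) : substAdd (c • F) = c • substAdd F := by
  ext i j
  simp only [substAdd, Pi.smul_apply]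
  rw [smul_finsum]
  exact finsum_congr fun k => smul_comm _ _ _

/-- The Leibniz rule for divided derivatives. On monomials it is the Chu–Vandermonde identity,
applied to `i + k = p.1 + (i + k - p.1)`. -/
theorem taylorTerm_conv {F : ℤ → ℤ → V} {G : ℤ → ℤ → K} (hF : F ∈ iterLaurent V)
    (hG : G ∈ iterLaurent K) (k : ℕ) :
    taylorTerm k (conv B F G) =
      ∑ ab ∈ Finset.HasAntidiagonal.antidiagonal k,
        conv B (taylorTerm ab.1 F) (taylorTerm ab.2 G) := by
  ext i j
  simp only [Finset.sum_apply, taylorTerm_apply, conv]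
  rw [smul_finsum' _ ((convolvable_of_mem hF hG).finite_support B (i + k) (j - k))]
  have h1 : ∀ p : ℤ × ℤ, (Ring.choose (i + k) k : ℤ) •
      B (F p.1 p.2) (G (i + k - p.1) (j - k - p.2)) = ∑ ab ∈ Finset.HasAntidiagonal.antidiagonal k,
      (Ring.choose p.1 ab.1 * Ring.choose (i + k - p.1) ab.2 : ℤ) •
        B (F p.1 p.2) (G (i + k - p.1) (j - k - p.2)) := by
    intro p
    rw [← Finset.sum_smul, ← Ring.add_choose_eq k (Commute.all _ _), add_sub_cancel]
  rw [finsum_congr h1, finsum_sum_comm]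
  · refine Finset.sum_congr rfl fun ab hab => ?_
    obtain ⟨a, b⟩ := ab
    have hk : a + b = k := Finset.HasAntidiagonal.mem_antidiagonal.mp hab
    -- The divided derivative of order `a` trades `x₁ ^ a` for `x₂ ^ a` in the first factor, hence
    -- the shift by `(a, -a)`.
    let e : ℤ × ℤ ≃ ℤ × ℤ := (Equiv.addRight (a : ℤ)).prodCongr (Equiv.subRight (a : ℤ))
    rw [← finsum_comp_equiv e]
    refine finsum_congr fun p => ?_
    simp only [e, Equiv.prodCongr_apply, Prod.map, Equiv.coe_addRight, Equiv.subRight_apply,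
      map_zsmul, LinearMap.smul_apply, smul_smul]
    rw [mul_comm, show i + (k : ℤ) - (p.1 + a) = i - p.1 + b by rw [← hk]; push_cast; ring,
      show j - (k : ℤ) - (p.2 - a) = j - p.2 - b by rw [← hk]; push_cast; ring]
  · intro ab _
    exact ((convolvable_of_mem hF hG).finite_support B (i + k) (j - k)).subset
      fun p hp h0 => hp (by simp only at h0; simp only [h0, smul_zero])

theorem sum_range_sum_antidiagonal {M : Type*} [AddCommMonoid M] (n : ℕ) (f : ℕ × ℕ → M)
    (hf : ∀ ab : ℕ × ℕ, n ≤ ab.1 + ab.2 → f ab = 0) :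
    ∑ k ∈ Finset.range n, ∑ ab ∈ Finset.HasAntidiagonal.antidiagonal k, f ab =
      ∑ a ∈ Finset.range n, ∑ b ∈ Finset.range n, f (a, b) := by
  symm
  rw [← Finset.sum_product', ← Finset.sum_filter_of_ne (p := fun ab => ab.1 + ab.2 < n)
    (fun ab _ h => by by_contra hc; exact h (hf ab (by omega))),
    ← Finset.sum_fiberwise_of_maps_to (t := Finset.range n) (g := fun ab : ℕ × ℕ => ab.1 + ab.2)]
  · refine Finset.sum_congr rfl fun k hk => Finset.sum_congr ?_ fun _ _ => rfl
    ext ⟨a, b⟩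
    simp only [Finset.HasAntidiagonal.mem_antidiagonal, Finset.mem_filter,
      Finset.mem_product, Finset.mem_range]
      at hk ⊢
    omega
  · intro ab hab
    simp only [Finset.mem_filter, Finset.mem_range] at hab ⊢
    exact hab.2

/-- Taylor's formula turns the substitution into a sum of divided derivatives, so multiplicativity
is the Leibniz rule summed over all orders. Each coefficient involves finitely many orders, and the
triangle `a + b < n` may be completed to a square. -/
theorem substAdd_conv {F : ℤ → ℤ → V} {G : ℤ → ℤ → K} (hF : F ∈ iterLaurent V)
    (hG : G ∈ iterLaurent K) :
    substAdd (conv B F G) = conv B (substAdd F) (substAdd G) := by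
  have hF' := hF
  have hG' := hG
  obtain ⟨⟨N, hN⟩, -⟩ := hF
  obtain ⟨⟨N', hN'⟩, -⟩ := hG
  have hB : ∀ {F : ℤ → ℤ → V} {G : ℤ → ℤ → K} {a b : ℤ}, (∀ j < a, ∀ i, F i j = 0) →
      (∀ j < b, ∀ i, G i j = 0) → ∀ j < a + b, ∀ i, conv B F G i j = 0 := by
    intro F G a b hF hG j hj i
    refine (finsum_congr fun p => ?_).trans finsum_zero
    rcases lt_or_ge p.2 a with h | h
    · simp [hF p.2 h]
    · simp [hG (j - p.2) (by omega)]
  ext i j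
  let n := (j - (N + N') + 1).toNat
  have hn : j < N + N' + n := by omega
  rw [substAdd_eq_sum (hB hN hN') hn]
  simp only [taylorTerm_conv hF' hG', Finset.sum_apply]
  rw [sum_range_sum_antidiagonal n
    (fun ab => conv B (taylorTerm ab.1 F) (taylorTerm ab.2 G) i j)]
  · have h1 : conv B (substAdd F) (substAdd G) i j = conv B
        (∑ a ∈ Finset.range n, taylorTerm a F) (∑ b ∈ Finset.range n, taylorTerm b G) i j := by
      refine finsum_congr fun p => ?_
      simp only [Finset.sum_apply]
      rcases lt_or_ge p.2 N with h | h
      · rw [substAdd_eq_sum hN (n := n) (by omega)]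
        rw [Finset.sum_eq_zero fun a _ => taylorTerm_eq_zero hN (by omega) _]
        simp
      rcases lt_or_ge (j - p.2) N' with h' | h'
      · rw [substAdd_eq_sum hN' (n := n) (by omega)]
        rw [Finset.sum_eq_zero fun a _ => taylorTerm_eq_zero hN' (by omega) _]
        simp
      rw [substAdd_eq_sum hN (n := n) (by omega), substAdd_eq_sum hN' (n := n) (by omega)]
    rw [h1, conv_sum_left _ (taylorTerm_mem hF')
      (Submodule.sum_mem _ fun b _ => taylorTerm_mem hG' b)]
    simp only [conv_sum_right _ (taylorTerm_mem hF' _) (taylorTerm_mem hG'), Finset.sum_apply]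
  · rintro ⟨a, b⟩ hab
    refine hB (a := N + a) (b := N' + b) (fun j hj i => taylorTerm_eq_zero hN hj i)
      (fun j hj i => taylorTerm_eq_zero hN' hj i) j ?_ i
    simp only at hab
    omega

end TwoVariable

/-! ### Compatible pairs: uniqueness and products. -/

section CompatiblePairs

variable {V W K U : Type*} [AddCommGroup V] [Module ℂ V] [AddCommGroup W] [Module ℂ W]
  [AddCommGroup K] [Module ℂ K] [AddCommGroup U] [Module ℂ U]

/-- Pairs of `A(x₁, x₂)` in `V((x₁))((x₂))` and `B(x₀, x₂)` in `V((x₂))((x₀))` with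
`(x₀ + x₂) ^ l A(x₀ + x₂, x₂) = (x₀ + x₂) ^ l B(x₀, x₂)` for some `l`. -/
def compatPair (V : Type*) [AddCommGroup V] [Module ℂ V] :
    Submodule ℂ ((ℤ → ℤ → V) × (ℤ → ℤ → V)) where
  carrier := {P | P.1 ∈ iterLaurent V ∧ P.2 ∈ iterLaurentSwap V ∧
    ∃ l : ℕ, (mulAdd ^ l) (substAdd P.1) = (mulAdd ^ l) P.2}
  zero_mem' := ⟨Submodule.zero_mem _, Submodule.zero_mem _, 0, by ext i j; simp [substAdd]⟩
  add_mem' := by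
    rintro P Q ⟨h1, h2, l, h⟩ ⟨h1', h2', l', h'⟩
    refine ⟨Submodule.add_mem _ h1 h1', Submodule.add_mem _ h2 h2', l + l', ?_⟩
    have e1 := congrArg (mulAdd ^ l') h
    have e2 := congrArg (mulAdd ^ l) h'
    rw [← Module.End.mul_apply, ← Module.End.mul_apply, ← pow_add] at e1 e2
    rw [add_comm] at e1
    rw [Prod.fst_add, Prod.snd_add, substAdd_add h1 h1', map_add, map_add, e1, e2]
  smul_mem' := by
    rintro c P ⟨h1, h2, l, h⟩
    refine ⟨Submodule.smul_mem _ c h1, Submodule.smul_mem _ c h2, l, ?_⟩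
    rw [Prod.smul_fst, Prod.smul_snd, substAdd_smul, map_smul, map_smul, h]

/-- The difference of the two second components lies in `V((x₂))((x₀))` and is killed by a power of
`x₀ + x₂`. This upgrades weak associativity to an equality without denominators whenever the iterate
side can be guessed. -/
theorem compatPair.snd_eq {P Q : compatPair V} (h : P.1.1 = Q.1.1) : P.1.2 = Q.1.2 := by
  obtain ⟨-, h2, l, hl⟩ := P.2
  obtain ⟨-, h2', l', hl'⟩ := Q.2
  rw [← sub_eq_zero]
  refine mulAdd_pow_injective (Submodule.sub_mem _ h2 h2') (l + l') ?_
  have e1 := congrArg (mulAdd ^ l') hl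
  have e2 := congrArg (mulAdd ^ l) hl'
  rw [← Module.End.mul_apply, ← Module.End.mul_apply, ← pow_add] at e1 e2
  rw [add_comm] at e1
  rw [map_sub, ← e1, ← e2, h, sub_self]

theorem conv_mem_compatPair (B : V →ₗ[ℂ] K →ₗ[ℂ] U) (P : compatPair V) (Q : compatPair K) :
    (conv B P.1.1 Q.1.1, conv B P.1.2 Q.1.2) ∈ compatPair U := by
  obtain ⟨h1, h2, l, h⟩ := P.2
  obtain ⟨h1', h2', l', h'⟩ := Q.2
  refine ⟨conv_mem h1 h1', conv_mem_swap h2 h2', l + l', ?_⟩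
  simp only
  rw [substAdd_conv h1 h1', mulAdd_pow_conv (fun l l' => convolvable_of_mem
    (mulAdd_pow_mem (substAdd_mem h1) l) (mulAdd_pow_mem (substAdd_mem h1') l')),
    mulAdd_pow_conv (fun l l' => convolvable_of_mem_swap
    (mulAdd_pow_mem_swap h2 l) (mulAdd_pow_mem_swap h2' l')), h, h']

/-- The product of compatible pairs with respect to a bilinear map. -/
def convPair (B : V →ₗ[ℂ] K →ₗ[ℂ] U) : compatPair V →ₗ[ℂ] compatPair K →ₗ[ℂ] compatPair U :=
  LinearMap.mk₂ ℂ (fun P Q => ⟨_, conv_mem_compatPair B P Q⟩)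
    (fun P P' Q => Subtype.ext (Prod.ext
      (conv_add_left (convolvable_of_mem P.2.1 Q.2.1) (convolvable_of_mem P'.2.1 Q.2.1))
      (conv_add_left (convolvable_of_mem_swap P.2.2.1 Q.2.2.1)
        (convolvable_of_mem_swap P'.2.2.1 Q.2.2.1))))
    (fun c _ _ => Subtype.ext (Prod.ext (conv_smul_left c _ _) (conv_smul_left c _ _)))
    (fun P Q Q' => Subtype.ext (Prod.ext
      (conv_add_right (convolvable_of_mem P.2.1 Q.2.1) (convolvable_of_mem P.2.1 Q'.2.1))
      (conv_add_right (convolvable_of_mem_swap P.2.2.1 Q.2.2.1)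
        (convolvable_of_mem_swap P.2.2.1 Q'.2.2.1))))
    (fun c _ _ => Subtype.ext (Prod.ext (conv_smul_right c _ _) (conv_smul_right c _ _)))

theorem convPair_fst (B : V →ₗ[ℂ] K →ₗ[ℂ] U) (P : compatPair V) (Q : compatPair K) :
    (convPair B P Q).1.1 = conv B P.1.1 Q.1.1 := rfl

theorem convPair_snd (B : V →ₗ[ℂ] K →ₗ[ℂ] U) (P : compatPair V) (Q : compatPair K) :
    (convPair B P Q).1.2 = conv B P.1.2 Q.1.2 := rfl

/-! ### Compatible pairs of scalar series. -/

theorem exists_coeff_eq_zero (f : LaurentSeries ℂ) : ∃ N : ℤ, ∀ n < N, f.coeff n = 0 :=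
  ⟨f.order, fun _ hn => HahnSeries.coeff_eq_zero_of_lt_order hn⟩

/-- The coefficients of `f(x₁)`. -/
def fstSeries (f : LaurentSeries ℂ) (i j : ℤ) : ℂ := if j = 0 then f.coeff i else 0

/-- The coefficients of `f(x₂)`. -/
def sndSeries (f : LaurentSeries ℂ) (i j : ℤ) : ℂ := if i = 0 then f.coeff j else 0

/-- The coefficients of `f(x₀ + x₂)`, expanded in nonnegative powers of `x₂`. -/
def taylorSeries (f : ℤ → ℂ) (i j : ℤ) : ℂ :=
  if 0 ≤ j then (Ring.choose (i + j) j.toNat : ℤ) • f (i + j) else 0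

/-- The coefficients of `f(x₁ - x₂)`, expanded in nonnegative powers of `x₂`. -/
def subSeries (f : LaurentSeries ℂ) (i j : ℤ) : ℂ :=
  if 0 ≤ j then ((-1) ^ j.toNat * Ring.choose (i + j) j.toNat : ℤ) • f.coeff (i + j) else 0

theorem fstSeries_mem (f : LaurentSeries ℂ) : fstSeries f ∈ iterLaurent ℂ := by
  obtain ⟨N, hN⟩ := exists_coeff_eq_zero f
  exact ⟨⟨0, fun j hj i => if_neg hj.ne⟩, fun j => ⟨N, fun i hi => by simp [fstSeries, hN i hi]⟩⟩

theorem sndSeries_mem (f : LaurentSeries ℂ) : sndSeries f ∈ iterLaurent ℂ := by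
  obtain ⟨N, hN⟩ := exists_coeff_eq_zero f
  exact ⟨⟨N, fun j hj i => by simp [sndSeries, hN j hj]⟩, fun j => ⟨0, fun i hi => if_neg hi.ne⟩⟩

theorem subSeries_mem (f : LaurentSeries ℂ) : subSeries f ∈ iterLaurent ℂ := by
  obtain ⟨N, hN⟩ := exists_coeff_eq_zero f
  refine ⟨⟨0, fun j hj i => if_neg (by omega)⟩, fun j => ⟨N - j, fun i hi => ?_⟩⟩
  simp [subSeries, hN (i + j) (by omega)]

theorem taylorSeries_mem (f : LaurentSeries ℂ) : taylorSeries f.coeff ∈ iterLaurent ℂ := by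
  obtain ⟨N, hN⟩ := exists_coeff_eq_zero f
  refine ⟨⟨0, fun j hj i => if_neg (by omega)⟩, fun j => ⟨N - j, fun i hi => ?_⟩⟩
  simp [taylorSeries, hN (i + j) (by omega)]

theorem swapVar_fstSeries (f : LaurentSeries ℂ) : swapVar (fstSeries f) = sndSeries f := rfl

theorem substAdd_sndSeries (f : LaurentSeries ℂ) : substAdd (sndSeries f) = sndSeries f := by
  ext i j
  rw [substAdd, finsum_eq_single _ 0]
  · simp
  · intro k hk
    rw [sndSeries]
    split_ifs with h
    · rw [h, Ring.choose_zero_pos ℤ (Nat.pos_of_ne_zero hk), zero_smul]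
    · rw [smul_zero]

theorem substAdd_fstSeries (f : LaurentSeries ℂ) :
    substAdd (fstSeries f) = taylorSeries f.coeff := by
  ext i j
  rw [substAdd, finsum_eq_single _ j.toNat]
  · rw [taylorSeries, fstSeries]
    by_cases h : 0 ≤ j
    · have hj : (j.toNat : ℤ) = j := by omega
      rw [if_pos h, hj, if_pos (sub_self j)]
    · rw [if_neg h, if_neg (by omega), smul_zero]
  · intro k hk
    rw [fstSeries, if_neg (by omega), smul_zero]

/-- Formally `f((x₀ + x₂) - x₂) = f(x₀)`. After rewriting `choose (i + k) k` as `(-1) ^ k choose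
(-(i + 1)) k`, Chu–Vandermonde sums the coefficient of `x₂ ^ n` to a multiple of `choose (n - 1) n`,
which is `1` for `n = 0` and `0` for `n > 0`. -/
theorem substAdd_subSeries (f : LaurentSeries ℂ) : substAdd (subSeries f) = fstSeries f := by
  ext i j
  rcases lt_or_ge j 0 with h | h
  · rw [fstSeries, if_neg h.ne]
    refine (finsum_congr fun k => ?_).trans finsum_zero
    rw [subSeries, if_neg (by omega), smul_zero]
  obtain ⟨n, rfl⟩ := Int.eq_ofNat_of_zero_le h
  rw [substAdd_eq_sum (F := subSeries f) (N := 0) (n := n + 1) (fun j hj i => if_neg (by omega))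
    (by push_cast; omega)]
  have h1 : ∀ k ∈ Finset.range (n + 1), taylorTerm k (subSeries f) i n =
      (((-1) ^ n * (Ring.choose (-(i + 1)) k * Ring.choose (i + n) (n - k)) : ℤ)) •
        f.coeff (i + n) := by
    intro k hk
    have hk' : k ≤ n := Nat.lt_succ_iff.mp (Finset.mem_range.mp hk)
    rw [taylorTerm_apply, subSeries, if_pos (by omega), smul_smul,
      show i + (k : ℤ) + ((n : ℤ) - k) = i + n by ring, show ((n : ℤ) - k).toNat = n - k by omega,
      Ring.choose_neg, show i + 1 + (k : ℤ) - 1 = i + k by ring]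
    congr 1
    have h2 : ((-1 : ℤ)) ^ n = (-1) ^ k * (-1) ^ (n - k) := by
      rw [← pow_add, Nat.add_sub_cancel' hk']
    have h3 : ((-1 : ℤ)) ^ k * (-1) ^ k = 1 := by rw [← mul_pow]; simp
    rw [h2, Units.smul_def, Int.coe_negOnePow_natCast, smul_eq_mul]
    linear_combination
      (-(Ring.choose (i + k) k * ((-1) ^ (n - k) * Ring.choose (i + n) (n - k)))) * h3
  rw [Finset.sum_congr rfl h1, ← Finset.sum_smul, ← Finset.mul_sum,
    ← Finset.Nat.sum_antidiagonal_eq_sum_range_succ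
      (fun a b => Ring.choose (-(i + 1)) a * Ring.choose (i + n) b),
    ← Ring.add_choose_eq n (Commute.all _ _), show -(i + 1) + (i + (n : ℤ)) = n - 1 by ring,
    fstSeries]
  rcases n with _ | n
  · simp
  · rw [Nat.cast_succ, add_sub_cancel_right, Ring.choose_natCast, Nat.choose_succ_self,
      if_neg (by omega)]
    simp

theorem mulAdd_taylorSeries (f : ℤ → ℂ) :
    mulAdd (taylorSeries f) = taylorSeries fun n => f (n - 1) := by
  ext i j
  rw [mulAdd_apply]
  simp only [taylorSeries]
  rcases lt_trichotomy j 0 with h | rfl | h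
  · rw [if_neg (by omega), if_neg (by omega), if_neg (by omega), add_zero]
  · simp
  obtain ⟨n, rfl⟩ : ∃ n : ℕ, j = n + 1 := ⟨(j - 1).toNat, by omega⟩
  rw [if_pos (by omega), if_pos (by omega), if_pos (by omega), add_sub_cancel_right,
    show ((n : ℤ) + 1).toNat = n + 1 by omega, Int.toNat_natCast,
    show i - 1 + ((n : ℤ) + 1) = i + n by ring, show i + ((n : ℤ) + 1) = i + n + 1 by ring,
    add_sub_cancel_right, ← add_smul, Ring.choose_succ_succ, add_comm]

theorem mulAdd_pow_taylorSeries (f : ℤ → ℂ) (l : ℕ) :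
    (mulAdd ^ l) (taylorSeries f) = taylorSeries fun n => f (n - l) := by
  induction l with
  | zero => simp
  | succ l ih =>
    rw [pow_succ', Module.End.mul_apply, ih, mulAdd_taylorSeries]
    congr 1
    ext n
    rw [Nat.cast_succ, sub_sub, add_comm]

/-- For a power series the expansions of `f(x₀ + x₂)` in either variable agree, by symmetry of the
binomial coefficients. For negative exponents of one variable, `choose (i + j) j` vanishes once `0 ≤
i + j < j`. -/
theorem swapVar_taylorSeries {f : ℤ → ℂ} (hf : ∀ n < 0, f n = 0) :
    swapVar (taylorSeries f) = taylorSeries f := by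
  have h1 : ∀ i j : ℤ, i < 0 → 0 ≤ j →
      (Ring.choose (i + j) j.toNat : ℤ) • f (i + j) = 0 := by
    intro i j hi hj
    rcases lt_or_ge (i + j) 0 with h | h
    · rw [hf _ h, smul_zero]
    · obtain ⟨n, hn⟩ := Int.eq_ofNat_of_zero_le h
      rw [hn, Ring.choose_natCast, Nat.choose_eq_zero_of_lt (by omega)]
      simp
  ext i j
  simp only [swapVar_apply, taylorSeries]
  by_cases hi : 0 ≤ i <;> by_cases hj : 0 ≤ j
  · obtain ⟨m, rfl⟩ := Int.eq_ofNat_of_zero_le hi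
    obtain ⟨n, rfl⟩ := Int.eq_ofNat_of_zero_le hj
    rw [if_pos hi, if_pos hj, Int.toNat_natCast, Int.toNat_natCast, add_comm (n : ℤ),
      ← Nat.cast_add, Ring.choose_natCast, Ring.choose_natCast, Nat.choose_symm_add]
  · rw [if_pos hi, if_neg hj, h1 j i (by omega) hi]
  · rw [if_neg hi, if_pos hj, h1 i j (by omega) hj]
  · rw [if_neg hi, if_neg hj]

theorem swapVar_mulAdd_pow (F : ℤ → ℤ → V) (l : ℕ) :
    swapVar ((mulAdd ^ l) F) = (mulAdd ^ l) (swapVar F) := by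
  induction l with
  | zero => simp
  | succ l ih =>
    rw [pow_succ', Module.End.mul_apply, Module.End.mul_apply, swapVar_mulAdd, ih]

/-- The pair `(f(x₁), f(x₂ + x₀))`. -/
def fstPair : LaurentSeries ℂ →ₗ[ℂ] compatPair ℂ where
  toFun f := ⟨(fstSeries f, swapVar (taylorSeries f.coeff)), fstSeries_mem f,
    taylorSeries_mem f, by
      obtain ⟨N, hN⟩ := exists_coeff_eq_zero f
      -- This power of `x₀ + x₂` clears the pole of `f`, leaving a power series, for which the two
      -- expansions agree.
      refine ⟨(-N).toNat, ?_⟩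
      simp only
      rw [substAdd_fstSeries, ← swapVar_mulAdd_pow, mulAdd_pow_taylorSeries,
        swapVar_taylorSeries fun n hn => hN _ (by omega)]⟩
  map_add' f g := Subtype.ext (Prod.ext
    (by ext i j; by_cases h : j = 0 <;> simp [fstSeries, h])
    (by ext i j; by_cases h : 0 ≤ i <;> simp [taylorSeries, h]))
  map_smul' c f := Subtype.ext (Prod.ext
    (by ext i j; by_cases h : j = 0 <;> simp [fstSeries, h])
    (by ext i j; by_cases h : 0 ≤ i <;> simp [taylorSeries, h, mul_left_comm]))

/-- The pair `(f(x₂), f(x₂))`. -/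
def sndPair : LaurentSeries ℂ →ₗ[ℂ] compatPair ℂ where
  toFun f := ⟨(sndSeries f, sndSeries f), sndSeries_mem f, fstSeries_mem f, 0, by
    simp only; rw [substAdd_sndSeries]⟩
  map_add' f g := Subtype.ext (Prod.ext
    (by ext i j; by_cases h : i = 0 <;> simp [sndSeries, h])
    (by ext i j; by_cases h : i = 0 <;> simp [sndSeries, h]))
  map_smul' c f := Subtype.ext (Prod.ext
    (by ext i j; by_cases h : i = 0 <;> simp [sndSeries, h])
    (by ext i j; by_cases h : i = 0 <;> simp [sndSeries, h]))

/-- The pair `(f(x₁ - x₂), f(x₀))`. -/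
def subPair : LaurentSeries ℂ →ₗ[ℂ] compatPair ℂ where
  toFun f := ⟨(subSeries f, fstSeries f), subSeries_mem f, sndSeries_mem f, 0, by
    simp only; rw [substAdd_subSeries]⟩
  map_add' f g := Subtype.ext (Prod.ext
    (by ext i j; by_cases h : 0 ≤ j <;> simp [subSeries, h])
    (by ext i j; by_cases h : j = 0 <;> simp [fstSeries, h]))
  map_smul' c f := Subtype.ext (Prod.ext
    (by ext i j; by_cases h : 0 ≤ j <;> simp [subSeries, h, mul_left_comm])
    (by ext i j; by_cases h : j = 0 <;> simp [fstSeries, h]))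

/-- The extension of `S : V → compatPair U` to `V ⊗ ℂ((x))`, where `f(x)` acts by
multiplication by the pair `χ f`. -/
def extPair (χ : LaurentSeries ℂ →ₗ[ℂ] compatPair ℂ) :
    (V →ₗ[ℂ] compatPair U) →ₗ[ℂ] V ⊗[ℂ] LaurentSeries ℂ →ₗ[ℂ] compatPair U where
  toFun S := TensorProduct.lift (((convPair (LinearMap.lsmul ℂ U)).flip ∘ₗ S).compl₂ χ)
  map_add' S T := TensorProduct.ext' fun v f => by simp
  map_smul' c S := TensorProduct.ext' fun v f => by simp

theorem extPair_tmul (χ : LaurentSeries ℂ →ₗ[ℂ] compatPair ℂ) (S : V →ₗ[ℂ] compatPair U) (v : V)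
    (f : LaurentSeries ℂ) :
    extPair χ S (v ⊗ₜ f) = convPair (LinearMap.lsmul ℂ U) (χ f) (S v) := rfl

theorem conv_sndSeries (f : LaurentSeries ℂ) (F : ℤ → ℤ → U) (i j : ℤ) :
    conv (LinearMap.lsmul ℂ U) (sndSeries f) F i j = ∑ᶠ b, f.coeff b • F i (j - b) := by
  rw [conv, finsum_eq_finsum_of_injective (g := fun b : ℤ => ((0 : ℤ), b))]
  · simp [sndSeries]
  · exact fun a b h => (Prod.ext_iff.mp h).2
  · rintro ⟨a, b⟩ h
    by_cases ha : a = 0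
    · exact ⟨b, by rw [ha]⟩
    · exact absurd (by simp [sndSeries, ha]) h

theorem conv_fstSeries (f : LaurentSeries ℂ) (F : ℤ → ℤ → U) (i j : ℤ) :
    conv (LinearMap.lsmul ℂ U) (fstSeries f) F i j = ∑ᶠ a, f.coeff a • F (i - a) j := by
  have h := conv_sndSeries f (swapVar F) j i
  rwa [← swapVar_fstSeries, conv_swapVar] at h

end CompatiblePairs

/-! ### Scalar series acting on vector-valued series. -/

section Series

variable {V W K U : Type*} [AddCommGroup V] [Module ℂ V] [AddCommGroup W] [Module ℂ W]
  [AddCommGroup K] [Module ℂ K] [AddCommGroup U] [Module ℂ U]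

theorem smul_support_finite (f : LaurentSeries ℂ) (A : Laurent W) (n : ℤ) :
    (Function.support fun i : ℤ => f.coeff i • cf (n - i) A).Finite := by
  obtain ⟨N, hN⟩ := exists_coeff_eq_zero f
  obtain ⟨M, hM⟩ := exists_cf_eq_zero A
  refine (Set.finite_Icc N (n - M)).subset fun i hi => ?_
  constructor <;> by_contra h
  · exact hi (by simp [hN i (by omega)])
  · exact hi (by simp [hM (n - i) (by omega)])

theorem cf_smul (f : LaurentSeries ℂ) (A : Laurent W) (n : ℤ) :
    cf n (f • A) = ∑ᶠ i : ℤ, f.coeff i • cf (n - i) A := by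
  have h : cf n (f • A) =
      ∑ ij ∈ Finset.VAddAntidiagonal n (Set.VAddAntidiagonal.finite_of_isPWO f.isPWO_support
        ((HahnModule.of ℂ).symm A).isPWO_support n), f.coeff ij.1 • cf ij.2 A := rfl
  let F : ℤ × ℤ → W := fun p => if p.1 + p.2 = n then f.coeff p.1 • cf p.2 A else 0
  have h1 : ∑ᶠ i : ℤ, f.coeff i • cf (n - i) A = ∑ᶠ p, F p := by
    rw [finsum_eq_finsum_of_injective (g := fun i : ℤ => (i, n - i))]
    · simp [F]
    · exact fun a b h => (Prod.ext_iff.mp h).1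
    · rintro ⟨a, b⟩ hp
      by_cases hab : a + b = n
      · exact ⟨a, by simp [← hab]⟩
      · exact absurd (if_neg hab) hp
  rw [h, h1, finsum_eq_sum_of_support_subset (s := Finset.VAddAntidiagonal n
    (Set.VAddAntidiagonal.finite_of_isPWO f.isPWO_support
        ((HahnModule.of ℂ).symm A).isPWO_support n))]
  · refine Finset.sum_congr rfl fun p hp => ?_
    rw [Finset.mem_vaddAntidiagonal] at hp
    exact (if_pos hp.2.2).symm
  · rintro ⟨a, b⟩ hp
    rw [Finset.mem_coe, Finset.mem_vaddAntidiagonal]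
    by_cases hab : a + b = n
    · have h2 : F (a, b) = f.coeff a • cf b A := if_pos hab
      refine ⟨fun h0 => hp ?_, fun h0 => hp ?_, hab⟩
      · rw [h2, h0, zero_smul]
      · rw [h2, show cf b A = 0 from h0, smul_zero]
    · exact absurd (if_neg hab) hp

theorem map_cf_smul (L : W →ₗ[ℂ] U) (f : LaurentSeries ℂ) (A : Laurent W) (n : ℤ) :
    L (cf n (f • A)) = ∑ᶠ i : ℤ, f.coeff i • L (cf (n - i) A) := by
  rw [cf_smul, map_finsum L (smul_support_finite f A n)]
  simp only [map_smul]

/-- The coefficient of `x₂ ^ k` of `A(x₁, x₂)` in `ℂ((x₁))((x₂))`. -/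
def seriesOf (F : ℤ → ℤ → ℂ) (hF : F ∈ iterLaurent ℂ) (k : ℤ) : LaurentSeries ℂ :=
  HahnSeries.ofSuppBddBelow (fun i => F i k) (by
    obtain ⟨M, hM⟩ := hF.2 k
    exact ⟨M, fun i hi => by by_contra h; exact hi (hM i (not_le.mp h))⟩)

@[simp] theorem coeff_seriesOf (F : ℤ → ℤ → ℂ) (hF : F ∈ iterLaurent ℂ) (k i : ℤ) :
    (seriesOf F hF k).coeff i = F i k := rfl

/-- The coefficient of `x₀ ^ q` of `f(x₂ + x₀)`. -/
def taylorCoeff (q : ℤ) : LaurentSeries ℂ →ₗ[ℂ] LaurentSeries ℂ where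
  toFun f := seriesOf (taylorSeries f.coeff) (taylorSeries_mem f) q
  map_add' f g := by
    ext i
    by_cases h : 0 ≤ q <;> simp [taylorSeries, h]
  map_smul' c f := by
    ext i
    by_cases h : 0 ≤ q <;> simp [taylorSeries, h, mul_left_comm]

theorem coeff_taylorCoeff (q : ℤ) (f : LaurentSeries ℂ) (i : ℤ) :
    (taylorCoeff q f).coeff i = taylorSeries f.coeff i q := rfl

theorem taylorCoeff_of_neg {q : ℤ} (hq : q < 0) : taylorCoeff q = 0 := by
  ext f i
  rw [coeff_taylorCoeff, taylorSeries, if_neg (by omega)]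
  rfl

/-- The coefficient of `x₂ ^ k` of `f(x₁ - x₂)`. -/
def subCoeff (k : ℤ) (f : LaurentSeries ℂ) : LaurentSeries ℂ :=
  seriesOf (subSeries f) (subSeries_mem f) k

theorem coeff_subCoeff (k : ℤ) (f : LaurentSeries ℂ) (i : ℤ) :
    (subCoeff k f).coeff i = subSeries f i k := rfl

theorem subCoeff_of_neg {k : ℤ} (hk : k < 0) (f : LaurentSeries ℂ) : subCoeff k f = 0 := by
  ext i
  rw [coeff_subCoeff, subSeries, if_neg (by omega)]
  rfl

theorem mem_iterLaurent_cf {a : Laurent V} (A : V →ₗ[ℂ] Laurent W) :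
    (fun m n => cf m (A (cf n a))) ∈ iterLaurent W := by
  obtain ⟨N, hN⟩ := exists_cf_eq_zero a
  refine ⟨⟨N, fun j hj i => by simp [hN j hj]⟩, fun j => ?_⟩
  obtain ⟨M, hM⟩ := exists_cf_eq_zero (A (cf j a))
  exact ⟨M, fun i hi => hM i hi⟩

/-- If the coefficients `F m n` of `F(x₁, x₂)` for `n < N` vanish, the product with
`f(x₁ - x₂)` is a finite sum over the powers of `x₂`. -/
theorem conv_subSeries_cf (f : LaurentSeries ℂ) (a : Laurent V) (A : V →ₗ[ℂ] Laurent W)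
    {N : ℤ} (hN : ∀ n < N, cf n a = 0) (i j : ℤ) :
    conv (LinearMap.lsmul ℂ W) (subSeries f) (fun m n => cf m (A (cf n a))) i j =
      ∑ k ∈ Finset.Icc 0 (j - N), cf i (subCoeff k f • A (cf (j - k) a)) := by
  rw [conv, ← finsum_comp_equiv (Equiv.prodComm ℤ ℤ), finsum_curry]
  · have h : ∀ k : ℤ, ∑ᶠ p : ℤ, LinearMap.lsmul ℂ W (subSeries f p k)
        (cf (i - p) (A (cf (j - k) a))) = cf i (subCoeff k f • A (cf (j - k) a)) := by
      intro k
      rw [cf_smul]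
      rfl
    refine (finsum_congr h).trans (finsum_eq_sum_of_support_subset _ fun k hk => ?_)
    simp only [Finset.coe_Icc]
    constructor <;> by_contra hc
    · exact hk (by simp only; rw [subCoeff_of_neg (by omega), cf_smul]; simp)
    · exact hk (by simp only; rw [hN (j - k) (by omega), map_zero, smul_zero, map_zero])
  · exact ((convolvable_of_mem (subSeries_mem f) (mem_iterLaurent_cf A)).finite_support
      (LinearMap.lsmul ℂ W) i j).preimage (Equiv.prodComm ℤ ℤ).injective.injOn

/-- Multiplication by `f(x)` on `V ⊗ ℂ((x))`. -/
def mulSeries : LaurentSeries ℂ →ₗ[ℂ] V ⊗[ℂ] LaurentSeries ℂ →ₗ[ℂ] V ⊗[ℂ] LaurentSeries ℂ :=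
  LinearMap.lTensorHom V ∘ₗ LinearMap.mk₂ ℂ (fun f g => f * g) add_mul
    (fun c f g => by rw [← HahnSeries.C_mul_eq_smul, ← HahnSeries.C_mul_eq_smul, mul_assoc])
    mul_add
    (fun c f g => by rw [← HahnSeries.C_mul_eq_smul, ← HahnSeries.C_mul_eq_smul, mul_left_comm])

theorem mulSeries_tmul (f : LaurentSeries ℂ) (v : V) (g : LaurentSeries ℂ) :
    mulSeries f (v ⊗ₜ g) = v ⊗ₜ[ℂ] (f * g) := rfl

theorem extendScalars_mulSeries (A : HVertexOperator ℤ ℂ V W) (f : LaurentSeries ℂ)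
    (t : V ⊗[ℂ] LaurentSeries ℂ) :
    extendScalars A (mulSeries f t) = f • extendScalars A t := by
  induction t with
  | zero => rw [map_zero, map_zero, smul_zero]
  | add x y hx hy => rw [map_add, map_add, hx, hy, map_add, smul_add]
  | tmul v g =>
    rw [mulSeries_tmul, extendScalars_tmul, extendScalars_tmul]
    exact mul_smul f g (A v)

/-- The pair `(v, v)` of constant series. -/
def constPair : V →ₗ[ℂ] compatPair V where
  toFun v := ⟨(fun i j => cf j (constLaurent (cf i (constLaurent v))),
    fun i j => cf j (constLaurent (cf i (constLaurent v)))), by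
      have h : (fun i j => cf j (constLaurent (cf i (constLaurent v)))) =
          fun i j => if j = 0 then (if i = 0 then v else 0) else 0 := by
        ext i j; simp [cf_constLaurent]
      have h1 : (fun i j => cf j (constLaurent (cf i (constLaurent v)))) ∈ iterLaurent V := by
        rw [h]
        exact ⟨⟨0, fun j hj i => if_neg hj.ne⟩, fun j => ⟨0, fun i hi => by
          simp only [if_neg hi.ne, ite_self]⟩⟩
      have h2 : swapVar (fun i j => cf j (constLaurent (cf i (constLaurent v)))) =
          fun i j => cf j (constLaurent (cf i (constLaurent v))) := by
        rw [h]; ext i j; by_cases hi : i = 0 <;> by_cases hj : j = 0 <;> simp [hi, hj]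
      refine ⟨h1, ?_, 0, ?_⟩
      · change swapVar _ ∈ iterLaurent V
        simp only
        rw [h2]
        exact h1
      · simp only [pow_zero, Module.End.one_apply]
        ext i j
        rw [h, substAdd, finsum_eq_single _ 0]
        · simp [cf_constLaurent]
        · intro k hk
          by_cases hik : i + k = 0
          · rw [hik, Ring.choose_zero_pos ℤ (Nat.pos_of_ne_zero hk), zero_smul]
          · simp [hik]⟩
  map_add' u v := Subtype.ext (Prod.ext (by ext i j; simp) (by ext i j; simp))
  map_smul' c v := Subtype.ext (Prod.ext (by ext i j; simp) (by ext i j; simp))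

theorem constPair_fst (v : V) (i j : ℤ) :
    (constPair v).1.1 i j = if j = 0 then (if i = 0 then v else 0) else 0 := by
  change cf j (constLaurent (cf i (constLaurent v))) = _
  simp [cf_constLaurent]

theorem constPair_snd (v : V) (i j : ℤ) :
    (constPair v).1.2 i j = if j = 0 then (if i = 0 then v else 0) else 0 :=
  constPair_fst v i j

theorem conv_const (F : ℤ → ℤ → ℂ) (G : ℤ → ℤ → V) (v : V)
    (hG : ∀ i j, G i j = if j = 0 then (if i = 0 then v else 0) else 0) (i j : ℤ) :
    conv (LinearMap.lsmul ℂ V) F G i j = F i j • v := by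
  rw [conv, finsum_eq_single _ (i, j)]
  · simp [hG]
  · rintro ⟨a, b⟩ h
    rw [hG]
    by_cases hb : j - b = 0
    · by_cases ha : i - a = 0
      · exact absurd (Prod.ext (by simp only; omega) (by simp only; omega)) h
      · simp [ha]
    · simp [hb]

/-- For `b(x)` in `V ⊗ ℂ((x))`, the pair `(b(x₁), b(x₂ + x₀))`. -/
def fstVecPair : V ⊗[ℂ] LaurentSeries ℂ →ₗ[ℂ] compatPair V := extPair fstPair constPair

theorem fstVecPair_fst (t : V ⊗[ℂ] LaurentSeries ℂ) (i j : ℤ) :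
    (fstVecPair t).1.1 i j = if j = 0 then cf i (tensorEmb V t) else 0 := by
  induction t with
  | zero => simp
  | add x y hx hy =>
    rw [map_add, map_add, map_add]
    change (fstVecPair x).1.1 i j + (fstVecPair y).1.1 i j = _
    rw [hx, hy]
    split_ifs <;> simp
  | tmul v f =>
    rw [cf_tensorEmb_tmul, fstVecPair, extPair_tmul, convPair_fst,
      conv_const _ _ v (constPair_fst v)]
    change fstSeries f i j • v = _
    simp [fstSeries]

theorem fstVecPair_snd (t : V ⊗[ℂ] LaurentSeries ℂ) (i j : ℤ) :
    (fstVecPair t).1.2 i j = cf j (tensorEmb V (LinearMap.lTensor V (taylorCoeff i) t)) := by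
  induction t with
  | zero => simp
  | add x y hx hy =>
    rw [map_add, map_add, map_add, map_add, ← hx, ← hy]
    rfl
  | tmul v f =>
    rw [LinearMap.lTensor_tmul, cf_tensorEmb_tmul, fstVecPair, extPair_tmul, convPair_snd,
      conv_const _ _ v (constPair_snd v)]
    rfl

end Series

/-! ### Finiteness and additivity of the twisted sums. -/

section Twisted

variable {V W : Type*} [AddCommGroup V] [Module ℂ V] [AddCommGroup W] [Module ℂ W]

/-- The powers of `x` in `Z(a', x) w'`, for coefficients `a'` of `a(x)` and `w'` of `w(x)`, are
bounded below. -/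
def BoundedBelow (Z : V →ₗ[ℂ] VertexOperator ℂ W) (a : Laurent V) (w : Laurent W) : Prop :=
  ∃ N : ℤ, ∀ m < N, ∀ n n', cf m (Z (cf n a) (cf n' w)) = 0

variable {Z : V →ₗ[ℂ] VertexOperator ℂ W}

/-- An element of `V ⊗ ℂ((x))` involves only finitely many vectors of `V`, so finitely many
truncation bounds suffice. A general element of `V((x))` gives no such uniform bound. -/
theorem boundedBelow_tensorEmb (a : V ⊗[ℂ] LaurentSeries ℂ) (b : W ⊗[ℂ] LaurentSeries ℂ) :
    BoundedBelow Z (tensorEmb V a) (tensorEmb W b) := by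
  induction a with
  | zero => exact ⟨0, fun m _ n n' => by simp⟩
  | add x y hx hy =>
    obtain ⟨N, hN⟩ := hx
    obtain ⟨M, hM⟩ := hy
    refine ⟨min N M, fun m hm n n' => ?_⟩
    rw [map_add, map_add, map_add, LinearMap.add_apply, map_add,
      hN m (lt_of_lt_of_le hm (min_le_left _ _)), hM m (lt_of_lt_of_le hm (min_le_right _ _)),
      add_zero]
  | tmul v f =>
    induction b with
    | zero => exact ⟨0, fun m _ n n' => by simp⟩
    | add x y hx hy =>
      obtain ⟨N, hN⟩ := hx
      obtain ⟨M, hM⟩ := hy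
      refine ⟨min N M, fun m hm n n' => ?_⟩
      rw [map_add, map_add, map_add, map_add,
        hN m (lt_of_lt_of_le hm (min_le_left _ _)), hM m (lt_of_lt_of_le hm (min_le_right _ _)),
        add_zero]
    | tmul w g =>
      obtain ⟨N, hN⟩ := exists_cf_eq_zero (Z v w)
      refine ⟨N, fun m hm n n' => ?_⟩
      rw [cf_tensorEmb_tmul, cf_tensorEmb_tmul]
      simp [hN m hm]

/-- The uniform bound on powers of `x₂` limits `k`; with `k` limited, truncation of `a(x)` and
`w(x)` limits `n` from below and above. -/
theorem BoundedBelow.support_finite {a : Laurent V} {w : Laurent W} (h : BoundedBelow Z a w)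
    (i j : ℤ) : (Function.support (twistedTerm Z a w i j)).Finite := by
  obtain ⟨N, hN⟩ := h
  obtain ⟨A, hA⟩ := exists_cf_eq_zero a
  obtain ⟨M, hM⟩ := exists_cf_eq_zero w
  refine ((Set.finite_Icc A (i + (j - N).toNat - M)).prod
    (Set.finite_Iic (j - N).toNat)).subset ?_
  rintro ⟨n, k⟩ hp
  have hk : k ≤ (j - N).toNat := by
    by_contra hc
    exact hp (by simp only [twistedTerm]; rw [hN _ (by omega), smul_zero])
  refine ⟨⟨?_, ?_⟩, hk⟩ <;> by_contra hc
  · exact hp (by simp only [twistedTerm]; rw [hA _ (not_le.mp hc)]; simp)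
  · simp only at hc
    exact hp (by simp only [twistedTerm]; rw [hM _ (by omega)]; simp)

theorem twistedCoeff_add_left {a a' : Laurent V} {w : Laurent W} (h : BoundedBelow Z a w)
    (h' : BoundedBelow Z a' w) (i j : ℤ) :
    twistedCoeff Z (a + a') w i j = twistedCoeff Z a w i j + twistedCoeff Z a' w i j := by
  rw [twistedCoeff, twistedCoeff, twistedCoeff,
    ← finsum_add_distrib (h.support_finite i j) (h'.support_finite i j)]
  exact finsum_congr fun p => by simp [twistedTerm]

theorem twistedCoeff_add_right {a : Laurent V} {w w' : Laurent W} (h : BoundedBelow Z a w)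
    (h' : BoundedBelow Z a w') (i j : ℤ) :
    twistedCoeff Z a (w + w') i j = twistedCoeff Z a w i j + twistedCoeff Z a w' i j := by
  rw [twistedCoeff, twistedCoeff, twistedCoeff,
    ← finsum_add_distrib (h.support_finite i j) (h'.support_finite i j)]
  exact finsum_congr fun p => by simp [twistedTerm]

theorem twistedCoeff_smul_left (c : ℂ) (a : Laurent V) (w : Laurent W) (i j : ℤ) :
    twistedCoeff Z (c • a) w i j = c • twistedCoeff Z a w i j := by
  rw [twistedCoeff, twistedCoeff, smul_finsum]
  refine finsum_congr fun p => ?_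
  simp only [twistedTerm, map_smul, LinearMap.smul_apply]
  rw [smul_comm]

theorem twistedCoeff_smul_right (c : ℂ) (a : Laurent V) (w : Laurent W) (i j : ℤ) :
    twistedCoeff Z a (c • w) i j = c • twistedCoeff Z a w i j := by
  rw [twistedCoeff, twistedCoeff, smul_finsum]
  refine finsum_congr fun p => ?_
  simp only [twistedTerm, map_smul]
  rw [smul_comm]

theorem twistedCoeff_zero_left (w : Laurent W) (i j : ℤ) : twistedCoeff Z 0 w i j = 0 := by
  rw [← zero_smul ℂ (0 : Laurent V), twistedCoeff_smul_left, zero_smul]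

theorem twistedCoeff_zero_right (a : Laurent V) (i j : ℤ) : twistedCoeff Z a 0 i j = 0 := by
  rw [← zero_smul ℂ (0 : Laurent W), twistedCoeff_smul_right, zero_smul]

theorem BoundedBelow.add_right {a : Laurent V} {w w' : Laurent W} (h : BoundedBelow Z a w)
    (h' : BoundedBelow Z a w') : BoundedBelow Z a (w + w') := by
  obtain ⟨N, hN⟩ := h
  obtain ⟨M, hM⟩ := h'
  refine ⟨min N M, fun m hm n n' => ?_⟩
  rw [map_add, map_add, map_add,
    hN m (lt_of_lt_of_le hm (min_le_left _ _)), hM m (lt_of_lt_of_le hm (min_le_right _ _)),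
    add_zero]

theorem BoundedBelow.zero_right (a : Laurent V) : BoundedBelow Z a 0 :=
  ⟨0, fun m _ n n' => by simp⟩

/-- On pure tensors the twisted product is `g(x₁) f(x₁ - x₂) Z(v, x₂)w`. Collecting by powers of
`x₂` makes it visibly a finite sum of vectors times series in `x₁`. -/
theorem twistedCoeff_tmul (v : V) (f : LaurentSeries ℂ) (w : W) (g : LaurentSeries ℂ) {N : ℤ}
    (hN : ∀ n < N, cf n (Z v w) = 0) (i j : ℤ) :
    twistedCoeff Z (tensorEmb V (v ⊗ₜ f)) (tensorEmb W (w ⊗ₜ g)) i j =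
      ∑ k ∈ Finset.Icc 0 (j - N), (g * subCoeff k f).coeff i • cf (j - k) (Z v w) := by
  have h1 : ∀ k : ℤ, (g * subCoeff k f).coeff i • cf (j - k) (Z v w) =
      ∑ᶠ r : ℤ, (g.coeff r * subSeries f (i - r) k) • cf (j - k) (Z v w) := by
    intro k
    have h2 : (g * subCoeff k f).coeff i =
        cf i (g • (HahnModule.of ℂ (subCoeff k f) : Laurent ℂ)) := rfl
    rw [h2, ← LinearMap.toSpanSingleton_apply ℂ W (cf (j - k) (Z v w)), map_cf_smul]
    refine finsum_congr fun r => ?_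
    rw [LinearMap.toSpanSingleton_apply, smul_smul]
    rfl
  obtain ⟨A, hA⟩ := exists_coeff_eq_zero f
  obtain ⟨B, hB⟩ := exists_coeff_eq_zero g
  rw [Finset.sum_congr rfl fun k _ => h1 k, ← finsum_eq_sum_of_support_subset
    (f := fun k => ∑ᶠ r : ℤ, (g.coeff r * subSeries f (i - r) k) • cf (j - k) (Z v w)),
    ← finsum_curry (fun p : ℤ × ℤ =>
      (g.coeff p.2 * subSeries f (i - p.2) p.1) • cf (j - p.1) (Z v w)), twistedCoeff]
  -- The term `(n, k)` uses the coefficient of `g` at `r = i - n + k`; conversely `k ≥ 0` and `r`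
  -- recover `n`.
  · rw [finsum_eq_finsum_of_injective (g := fun p : ℤ × ℕ => ((p.2 : ℤ), i - p.1 + p.2))]
    · refine finsum_congr fun p => ?_
      rw [twistedTerm, cf_tensorEmb_tmul, cf_tensorEmb_tmul, subSeries, if_pos (by omega),
        show i - (i - p.1 + p.2) + (p.2 : ℤ) = p.1 by ring, Int.toNat_natCast]
      simp only [map_smul, LinearMap.smul_apply, smul_smul, zsmul_eq_mul]
      rw [← Int.cast_smul_eq_zsmul ℂ, smul_smul]
      congr 1
      ring
    · rintro ⟨n, k⟩ ⟨n', k'⟩ h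
      simp only [Prod.mk.injEq] at h ⊢
      omega
    · rintro ⟨k, r⟩ h
      rcases lt_or_ge k 0 with hk | hk
      · exact absurd (by simp [subSeries, not_le.mpr hk]) h
      · exact ⟨(i - r + k, k.toNat), by simp only [Prod.mk.injEq]; omega⟩
  · refine ((Set.finite_Icc 0 (j - N)).prod
      (Set.finite_Icc B (i + (j - N) - A))).subset ?_
    rintro ⟨k, r⟩ h
    have hk : 0 ≤ k := by
      by_contra hc
      exact h (by simp [subSeries, hc])
    have hk' : k ≤ j - N := by
      by_contra hc
      exact h (by simp only; rw [hN _ (by omega), smul_zero])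
    refine ⟨⟨hk, hk'⟩, ?_, ?_⟩ <;> by_contra hc <;> simp only at hc
    · exact h (by simp only; rw [hB _ (by omega), zero_mul, zero_smul])
    · exact h (by simp [subSeries, hA (i - r + k) (by omega)])
  · intro k hk
    simp only [Finset.coe_Icc]
    constructor <;> by_contra hc
    · exact hk (by simp [subSeries, hc])
    · exact hk (by simp [hN (j - k) (by omega)])

end Twisted

/-! ### Compatible pairs built from vertex operators. -/

section Operators

variable {V W H : Type*} [AddCommGroup V] [Module ℂ V] [AddCommGroup W] [Module ℂ W]
  [AddCommGroup H] [Module ℂ H]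

theorem opPair_mem {Y : V →ₗ[ℂ] VertexOperator ℂ V} {YW : V →ₗ[ℂ] VertexOperator ℂ W}
    (h : WeakAssoc Y YW) (u v : V) (w : W) :
    ((fun m n => cf m (YW u (cf n (YW v w))), fun m n => cf n (YW (cf m (Y u v)) w)) :
      (ℤ → ℤ → W) × (ℤ → ℤ → W)) ∈ compatPair W := by
  refine ⟨mem_iterLaurent_cf (YW u), ?_, ?_⟩
  -- The iterate has the same shape with the variables exchanged: `x₀` is now the outer variable,
  -- carried by `Y(u, x₀)v`.
  · exact mem_iterLaurent_cf (a := Y u v) (YW.flip w)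
  · obtain ⟨l, hl⟩ := h u v w
    refine ⟨l, ?_⟩
    rw [← mulAddPow_eq, ← mulAddPow_eq]
    ext i j
    exact hl i j

/-- The pair `(Y_W(u, x₁) Y_W(v, x₂) w, Y_W(Y(u, x₀) v, x₂) w)`. -/
def opPair {Y : V →ₗ[ℂ] VertexOperator ℂ V} {YW : V →ₗ[ℂ] VertexOperator ℂ W}
    (h : WeakAssoc Y YW) : V →ₗ[ℂ] V →ₗ[ℂ] W →ₗ[ℂ] compatPair W where
  toFun u := LinearMap.mk₂ ℂ (fun v w => ⟨_, opPair_mem h u v w⟩)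
    (fun v v' w => Subtype.ext (Prod.ext (by ext i j; simp) (by ext i j; simp)))
    (fun c v w => Subtype.ext (Prod.ext (by ext i j; simp) (by ext i j; simp)))
    (fun v w w' => Subtype.ext (Prod.ext (by ext i j; simp) (by ext i j; simp)))
    (fun c v w => Subtype.ext (Prod.ext (by ext i j; simp) (by ext i j; simp)))
  map_add' u u' := LinearMap.ext₂ fun v w =>
    Subtype.ext (Prod.ext (by ext i j; simp) (by ext i j; simp))
  map_smul' c u := LinearMap.ext₂ fun v w =>
    Subtype.ext (Prod.ext (by ext i j; simp) (by ext i j; simp))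

variable (YH : H →ₗ[ℂ] VertexOperator ℂ H) (YVH : H →ₗ[ℂ] VertexOperator ℂ V)
  (hr : ∀ (h : H) (v : V), YVH h v ∈ LinearMap.range (tensorEmb V))

/-- The coefficient of `x₀ ^ q` of the `ℂ((x₂))`-linear map on `V ⊗ ℂ((x₂))` extending
`Y(h, x₂ + x₀)`, expanded in nonnegative powers of `x₀`. -/
def actSeries (q : ℤ) (h : H) : V ⊗[ℂ] LaurentSeries ℂ →ₗ[ℂ] V ⊗[ℂ] LaurentSeries ℂ :=
  TensorProduct.lift (mulSeries.flip ∘ₗ LinearMap.lTensor V (taylorCoeff q) ∘ₗ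
    liftAction YVH hr h)

theorem actSeries_tmul (q : ℤ) (h : H) (w : V) (f : LaurentSeries ℂ) :
    actSeries YVH hr q h (w ⊗ₜ f) =
      mulSeries f (LinearMap.lTensor V (taylorCoeff q) (liftAction YVH hr h w)) := rfl

theorem actSeries_of_neg {q : ℤ} (hq : q < 0) (h : H) : actSeries YVH hr q h = 0 :=
  TensorProduct.ext' fun w f => by
    rw [actSeries_tmul, taylorCoeff_of_neg hq, LinearMap.lTensor_zero, LinearMap.zero_apply,
      map_zero, LinearMap.zero_apply]

/-- The pair `(Y(h, x₁) t(x₂), Y(h, x₂ + x₀) t(x₂))` for `t(x)` in `V ⊗ ℂ((x))`. -/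
def actPair (h : H) : V ⊗[ℂ] LaurentSeries ℂ →ₗ[ℂ] compatPair V :=
  extPair sndPair (fstVecPair ∘ₗ liftAction YVH hr h)

theorem actPair_fst (h : H) (t : V ⊗[ℂ] LaurentSeries ℂ) (m n : ℤ) :
    (actPair YVH hr h t).1.1 m n = cf m (YVH h (cf n (tensorEmb V t))) := by
  induction t with
  | zero => simp
  | add x y hx hy =>
    rw [map_add, map_add, map_add, map_add, map_add, ← hx, ← hy]
    rfl
  | tmul w f =>
    rw [actPair, extPair_tmul, convPair_fst]
    change conv _ (sndSeries f) _ m n = _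
    rw [conv_sndSeries, finsum_eq_single _ n]
    · simp only [LinearMap.comp_apply]
      rw [fstVecPair_fst, if_pos (sub_self n), tensorEmb_liftAction, cf_tensorEmb_tmul, map_smul,
        map_smul]
    · intro b hb
      simp only [LinearMap.comp_apply]
      rw [fstVecPair_fst, if_neg (by omega), smul_zero]

theorem actPair_snd (h : H) (t : V ⊗[ℂ] LaurentSeries ℂ) (q j : ℤ) :
    (actPair YVH hr h t).1.2 q j = cf j (tensorEmb V (actSeries YVH hr q h t)) := by
  induction t with
  | zero => simp
  | add x y hx hy =>
    rw [map_add, map_add, map_add, map_add, ← hx, ← hy]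
    rfl
  | tmul w f =>
    rw [actPair, extPair_tmul, convPair_snd]
    change conv _ (sndSeries f) _ q j = _
    rw [conv_sndSeries, actSeries_tmul, tensorEmb, extendScalars_mulSeries, cf_smul]
    exact finsum_congr fun b => congrArg _ (fstVecPair_snd _ _ _)

variable {YH} in
-- `Y(Y(h, x₀)k, x₂)w` and `Y(h, x₂ + x₀)Y(k, x₂)w` are second components of compatible pairs with
-- the same first component `Y(h, x₁)Y(k, x₂)w`, hence equal. The equality is one in `V ⊗ ℂ((x₂))`,
-- to which `Y(u, x₂)` can then be applied.
theorem liftAction_cf (hA : WeakAssoc YH YVH) (h k : H) (w : V) (q : ℤ) :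
    liftAction YVH hr (cf q (YH h k)) w = actSeries YVH hr q h (liftAction YVH hr k w) := by
  refine tensorEmb_injective (cf_ext fun j => ?_)
  have h1 : (opPair hA h k w).1.2 = (actPair YVH hr h (liftAction YVH hr k w)).1.2 :=
    compatPair.snd_eq (by
      ext m n
      rw [actPair_fst, tensorEmb_liftAction]
      rfl)
  rw [← actPair_snd, ← h1, tensorEmb_liftAction]
  rfl

variable {Y : V →ₗ[ℂ] VertexOperator ℂ V} (hY : WeakAssoc Y Y)

/-- The pair `(Y(u, x₁) Y(a(x₁ - x₂), x₂) w, Y(Y(u, x₀) a(x₀), x₂) w)` for `a(x)` in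
`V ⊗ ℂ((x))`. -/
def subOpPair (u : V) : V ⊗[ℂ] LaurentSeries ℂ →ₗ[ℂ] V →ₗ[ℂ] compatPair V :=
  (extPair subPair ∘ₗ (opPair hY u).flip).flip

theorem subOpPair_tmul (u v : V) (f : LaurentSeries ℂ) (w : V) :
    subOpPair hY u (v ⊗ₜ f) w =
      convPair (LinearMap.lsmul ℂ V) (subPair f) (opPair hY u v w) := rfl

theorem subOpPair_snd (u : V) (a : V ⊗[ℂ] LaurentSeries ℂ) (w : V) (p j : ℤ) :
    (subOpPair hY u a w).1.2 p j = cf j (Y (cf p (extendScalars (Y u) a)) w) := by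
  induction a with
  | zero => simp
  | add x y hx hy =>
    rw [map_add, map_add, map_add, map_add, LinearMap.add_apply, LinearMap.add_apply, map_add,
      ← hx, ← hy]
    rfl
  | tmul v f =>
    rw [subOpPair_tmul, convPair_snd]
    change conv _ (fstSeries f) _ p j = _
    rw [conv_fstSeries]
    exact (map_cf_smul (cf j ∘ₗ Y.flip w) f (Y u v) p).symm

/-- The index `q` is the power of `x₀` taken from `b(x₂ + x₀)`. It is nonnegative, and the rest `i -
q` must be at least `M`, so the sum is finite. -/
theorem extPair_fstPair_subOpPair_snd (u : V) (a b : V ⊗[ℂ] LaurentSeries ℂ) {M : ℤ}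
    (hM : ∀ p < M, cf p (extendScalars (Y u) a) = 0) (i j : ℤ) :
    (extPair fstPair (subOpPair hY u a) b).1.2 i j = ∑ q ∈ Finset.Icc 0 (i - M),
      cf j (extendScalars (Y (cf (i - q) (extendScalars (Y u) a)))
        (LinearMap.lTensor V (taylorCoeff q) b)) := by
  induction b with
  | zero => simp
  | add x y hx hy =>
    simp only [map_add, Finset.sum_add_distrib]
    rw [← hx, ← hy]
    rfl
  | tmul w g =>
    rw [extPair_tmul, convPair_snd]
    change conv _ (swapVar (taylorSeries g.coeff)) _ i j = _
    rw [conv, finsum_curry]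
    · rw [← finsum_eq_sum_of_support_subset (f := fun q => cf j (extendScalars
        (Y (cf (i - q) (extendScalars (Y u) a)))
        (LinearMap.lTensor V (taylorCoeff q) (w ⊗ₜ[ℂ] g))))]
      · refine finsum_congr fun q => ?_
        rw [LinearMap.lTensor_tmul, extendScalars_tmul, cf_smul]
        refine finsum_congr fun s => ?_
        simp only
        rw [subOpPair_snd]
        rfl
      · intro q hq
        simp only [Finset.coe_Icc]
        constructor <;> by_contra hc
        · exact hq (by simp [taylorCoeff_of_neg (not_le.mp hc)])
        · refine hq ?_
          simp only
          rw [hM (i - q) (by omega), map_zero, LinearMap.lTensor_tmul, extendScalars_tmul,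
            LinearMap.zero_apply, smul_zero, map_zero]
    · exact (convolvable_of_mem_swap (fstPair g).2.2.1
        (subOpPair hY u a w).2.2.1).finite_support _ i j

/-- The pair of `Y(u, x₁) Y(Y(h₁, x₁ - x₂) v, x₂) Y(h₂, x₁) t(x₂)` and
`Y(Y(u, x₀) Y(h₁, x₀) v, x₂) Y(h₂, x₂ + x₀) t(x₂)`. -/
def actOpPair (u v : V) (t : V ⊗[ℂ] LaurentSeries ℂ) : H →ₗ[ℂ] H →ₗ[ℂ] compatPair V :=
  LinearMap.mk₂ ℂ
    (fun g h => extPair sndPair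
      (extPair fstPair (subOpPair hY u (liftAction YVH hr g v)) ∘ₗ liftAction YVH hr h) t)
    (fun g g' h => by
      simp only [map_add, LinearMap.add_apply, LinearMap.add_comp])
    (fun c g h => by
      simp only [map_smul, LinearMap.smul_apply, LinearMap.smul_comp])
    (fun g h h' => by
      simp only [map_add, LinearMap.add_apply, LinearMap.comp_add])
    (fun c g h => by
      simp only [map_smul, LinearMap.smul_apply, LinearMap.comp_smul])

theorem actOpPair_apply (u v : V) (t : V ⊗[ℂ] LaurentSeries ℂ) (g h : H) :
    actOpPair YVH hr hY u v t g h = extPair sndPair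
      (extPair fstPair (subOpPair hY u (liftAction YVH hr g v)) ∘ₗ liftAction YVH hr h) t := rfl

theorem actOpPair_snd (u v : V) (t : V ⊗[ℂ] LaurentSeries ℂ) (g h : H) {M : ℤ}
    (hM : ∀ p < M, cf p (extendScalars (Y u) (liftAction YVH hr g v)) = 0) (i j : ℤ) :
    (actOpPair YVH hr hY u v t g h).1.2 i j = ∑ q ∈ Finset.Icc 0 (i - M),
      cf j (extendScalars (Y (cf (i - q) (extendScalars (Y u) (liftAction YVH hr g v))))
        (actSeries YVH hr q h t)) := by
  rw [actOpPair_apply]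
  induction t with
  | zero => simp
  | add x y hx hy =>
    simp only [map_add, Finset.sum_add_distrib]
    rw [← hx, ← hy]
    rfl
  | tmul w f =>
    rw [extPair_tmul, convPair_snd]
    change conv _ (sndSeries f) _ i j = _
    rw [conv_sndSeries]
    simp only [actSeries_tmul, extendScalars_mulSeries, cf_smul, LinearMap.comp_apply]
    rw [← finsum_sum_comm]
    · refine finsum_congr fun b => ?_
      rw [extPair_fstPair_subOpPair_snd hY u _ _ hM, Finset.smul_sum]
    · intro q _
      exact smul_support_finite f _ j

/-- The extended operator `Y(u, x₁)` acts on `V ⊗ ℂ((x₁))` only, so each coefficient in `x₂` of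
`Y(a(x₁ - x₂), x₂)b(x₁)` must first be lifted there. The finite sum for pure tensors provides the
lift, and applying `Y(u, x₁)` to it reproduces the first component of the pair. -/
theorem exists_tensorEmb_eq_twistedCoeff (u : V) (a b : V ⊗[ℂ] LaurentSeries ℂ) (q : ℤ) :
    ∃ T : V ⊗[ℂ] LaurentSeries ℂ,
      (∀ i, cf i (tensorEmb V T) = twistedCoeff Y (tensorEmb V a) (tensorEmb V b) i q) ∧
      ∀ i, cf i (extendScalars (Y u) T) =
        (extPair fstPair (subOpPair hY u a) b).1.1 i q := by
  induction a with
  | zero => exact ⟨0, fun i => by simp [twistedCoeff_zero_left], fun i => by simp⟩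
  | add x y hx hy =>
    obtain ⟨S, hS, hS'⟩ := hx
    obtain ⟨T, hT, hT'⟩ := hy
    refine ⟨S + T, fun i => ?_, fun i => ?_⟩
    · rw [map_add, map_add, map_add, twistedCoeff_add_left (boundedBelow_tensorEmb _ _)
        (boundedBelow_tensorEmb _ _), hS, hT]
    · simp only [map_add]
      rw [hS', hT']
      rfl
  | tmul v f =>
    induction b with
    | zero => exact ⟨0, fun i => by simp [twistedCoeff_zero_right], fun i => by simp⟩
    | add x y hx hy =>
      obtain ⟨S, hS, hS'⟩ := hx
      obtain ⟨T, hT, hT'⟩ := hy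
      refine ⟨S + T, fun i => ?_, fun i => ?_⟩
      · rw [map_add, map_add, map_add, twistedCoeff_add_right (boundedBelow_tensorEmb _ _)
          (boundedBelow_tensorEmb _ _), hS, hT]
      · simp only [map_add]
        rw [hS', hT']
        rfl
    | tmul w g =>
      obtain ⟨N, hN⟩ := exists_cf_eq_zero (Y v w)
      refine ⟨∑ k ∈ Finset.Icc 0 (q - N), cf (q - k) (Y v w) ⊗ₜ (g * subCoeff k f),
        fun i => ?_, fun i => ?_⟩
      · rw [twistedCoeff_tmul v f w g hN]
        simp only [map_sum, cf_tensorEmb_tmul]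
      · rw [extPair_tmul, convPair_fst]
        change _ = conv _ (fstSeries g) _ i q
        rw [conv_fstSeries]
        have h1 : ∀ r : ℤ, g.coeff r • (subOpPair hY u (v ⊗ₜ[ℂ] f) w).1.1 (i - r) q =
            ∑ k ∈ Finset.Icc 0 (q - N), g.coeff r •
              cf (i - r) (subCoeff k f • Y u (cf (q - k) (Y v w))) := by
          intro r
          rw [← Finset.smul_sum, ← conv_subSeries_cf f (Y v w) (Y u) hN]
          rfl
        rw [finsum_congr h1, finsum_sum_comm]
        · simp only [map_sum, extendScalars_tmul, ← cf_smul]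
          exact Finset.sum_congr rfl fun k _ => congrArg (cf i)
            (mul_smul g (subCoeff k f) (Y u (cf (q - k) (Y v w))))
        · intro k _
          exact smul_support_finite g _ i

end Operators

/-! ### The module algebra identity read as a first component. -/

section Smash

variable {V H : Type*} [AddCommGroup V] [Module ℂ V] [AddCommGroup H] [Module ℂ H]
  [Coalgebra ℂ H]

/-- The module algebra identity is assumed for index types in `Type` only; indexing by `Fin n` makes
it available whatever the universe of `H`. -/
theorem exists_repr_fin (h : H) : ∃ n : ℕ, Nonempty (Coalgebra.Repr ℂ h (Fin n)) := by
  let r := Coalgebra.Repr.arbitrary ℂ h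
  let e := r.index.equivFin
  refine ⟨r.index.card, ⟨⟨Finset.univ, fun i => r.left (e.symm i), fun i => r.right (e.symm i),
    ?_⟩⟩⟩
  rw [← r.eq, ← Finset.sum_coe_sort r.index]
  exact Equiv.sum_comp e.symm fun i : r.index => r.left i ⊗ₜ[ℂ] r.right i

variable {YH : H →ₗ[ℂ] VertexOperator ℂ H} {vacH : H} {Y : V →ₗ[ℂ] VertexOperator ℂ V} {vac : V}
  {YVH : H →ₗ[ℂ] VertexOperator ℂ V}
  (hV : IsModuleNonlocalVertexAlgebra YH vacH Y vac YVH)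

/-- The module algebra identity rewrites `Y(h, x₁)Y(v, x₂)w`. Its two sides agree as lifts in `V ⊗
ℂ((x₁))` because the embedding is injective, so `Y(u, x₁)` may be applied to both. -/
theorem cf_extendScalars_liftAction_cf {ι : Type} (u v w : V) {h : H} (r : Coalgebra.Repr ℂ h ι)
    (i q : ℤ) :
    cf i (extendScalars (Y u) (liftAction YVH hV.mem_range h (cf q (Y v w)))) =
      ∑ s ∈ r.index, (extPair fstPair (subOpPair hV.isNonlocalVertexAlgebra.weak_assoc u
        (liftAction YVH hV.mem_range (r.left s) v))
          (liftAction YVH hV.mem_range (r.right s) w)).1.1 i q := by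
  choose T hT hT' using fun s => exists_tensorEmb_eq_twistedCoeff
    hV.isNonlocalVertexAlgebra.weak_assoc u (liftAction YVH hV.mem_range (r.left s) v)
      (liftAction YVH hV.mem_range (r.right s) w) q
  have h1 : liftAction YVH hV.mem_range h (cf q (Y v w)) = ∑ s ∈ r.index, T s := by
    refine tensorEmb_injective (cf_ext fun i => ?_)
    rw [tensorEmb_liftAction, hV.act_op h v w r, map_sum, map_sum]
    refine Finset.sum_congr rfl fun s _ => ?_
    rw [hT, tensorEmb_liftAction, tensorEmb_liftAction]
  rw [h1, map_sum, map_sum]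
  exact Finset.sum_congr rfl fun s _ => hT' s i

/-- Extends the preceding identity from `w` to `t(x₂)`, using linearity over `ℂ((x₂))`. -/
theorem cf_extendScalars_liftAction {ι : Type} (u v : V) (t : V ⊗[ℂ] LaurentSeries ℂ) {h : H}
    (r : Coalgebra.Repr ℂ h ι) (i j : ℤ) :
    cf i (extendScalars (Y u) (liftAction YVH hV.mem_range h (cf j (extendScalars (Y v) t)))) =
      ∑ s ∈ r.index, (actOpPair YVH hV.mem_range hV.isNonlocalVertexAlgebra.weak_assoc u v t
        (r.left s) (r.right s)).1.1 i j := by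
  simp only [actOpPair_apply]
  induction t with
  | zero => simp
  | add x y hx hy =>
    simp only [map_add]
    rw [hx, hy, ← Finset.sum_add_distrib]
    rfl
  | tmul w f =>
    rw [extendScalars_tmul]
    refine (map_cf_smul (cf i ∘ₗ extendScalars (Y u) ∘ₗ liftAction YVH hV.mem_range h)
      f (Y v w) j).trans ?_
    have h1 : ∀ s, (extPair sndPair (extPair fstPair (subOpPair
        hV.isNonlocalVertexAlgebra.weak_assoc u (liftAction YVH hV.mem_range (r.left s) v)) ∘ₗ
        liftAction YVH hV.mem_range (r.right s)) (w ⊗ₜ[ℂ] f)).1.1 i j = ∑ᶠ b : ℤ, f.coeff b •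
        (extPair fstPair (subOpPair hV.isNonlocalVertexAlgebra.weak_assoc u
        (liftAction YVH hV.mem_range (r.left s) v))
          (liftAction YVH hV.mem_range (r.right s) w)).1.1 i (j - b) := fun s => by
      rw [extPair_tmul, convPair_fst]
      exact conv_sndSeries f _ i j
    rw [Finset.sum_congr rfl fun s _ => h1 s, ← finsum_sum_comm]
    · refine finsum_congr fun b => ?_
      rw [← Finset.smul_sum]
      exact congrArg _ (cf_extendScalars_liftAction_cf hV u v w r i (j - b))
    · intro s _
      obtain ⟨N, hN⟩ := exists_coeff_eq_zero f
      obtain ⟨⟨M, hM⟩, -⟩ := (extPair fstPair (subOpPair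
        hV.isNonlocalVertexAlgebra.weak_assoc u (liftAction YVH hV.mem_range (r.left s) v))
          (liftAction YVH hV.mem_range (r.right s) w)).2.1
      refine (Set.finite_Icc N (j - M)).subset fun b hb => ?_
      constructor <;> by_contra hc
      · exact hb (by simp only; rw [hN b (not_le.mp hc), zero_smul])
      · exact hb (by simp only; rw [hM (j - b) (by omega), smul_zero])

end Smash

/-! ### The compatible pair behind the smash product. -/

section SmashAssoc

variable {V H : Type*} [AddCommGroup V] [Module ℂ V] [AddCommGroup H] [Module ℂ H]

theorem compatPair.sum_fst {ι : Type*} (s : Finset ι) (P : ι → compatPair V) (i j : ℤ) :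
    (∑ a ∈ s, P a).1.1 i j = ∑ a ∈ s, (P a).1.1 i j := by
  rw [AddSubmonoidClass.coe_finsetSum, Prod.fst_sum, Finset.sum_apply, Finset.sum_apply]

theorem compatPair.sum_snd {ι : Type*} (s : Finset ι) (P : ι → compatPair V) (i j : ℤ) :
    (∑ a ∈ s, P a).1.2 i j = ∑ a ∈ s, (P a).1.2 i j := by
  rw [AddSubmonoidClass.coe_finsetSum, Prod.snd_sum, Finset.sum_apply, Finset.sum_apply]

variable {YH : H →ₗ[ℂ] VertexOperator ℂ H} {Y : V →ₗ[ℂ] VertexOperator ℂ V}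
  (YVH : H →ₗ[ℂ] VertexOperator ℂ V)
  (hr : ∀ (h : H) (v : V), YVH h v ∈ LinearMap.range (tensorEmb V))

/-- The pair of `Y(u, x₁) Y(Y(g, x₁ - x₂) v, x₂) Y(h, x₁) t(x₂) ⊗ Y(h', x₁) Y(k, x₂) m` and
`Y(Y(u, x₀) Y(g, x₀) v, x₂) Y(h, x₂ + x₀) t(x₂) ⊗ Y(Y(h', x₀) k, x₂) m` at
`g ⊗ (h ⊗ h')`. -/
def smashPair (hY : WeakAssoc Y Y) (hYH : WeakAssoc YH YH) (u v : V)
    (t : V ⊗[ℂ] LaurentSeries ℂ) (k m : H) :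
    H ⊗[ℂ] (H ⊗[ℂ] H) →ₗ[ℂ] compatPair (V ⊗[ℂ] H) :=
  TensorProduct.lift
    { toFun g := TensorProduct.lift ((convPair (TensorProduct.mk ℂ V H) ∘ₗ
        actOpPair YVH hr hY u v t g).compl₂ (((opPair hYH).flip k).flip m))
      map_add' g g' := TensorProduct.ext' fun h h' => by simp
      map_smul' c g := TensorProduct.ext' fun h h' => by simp }

theorem smashPair_tmul (hY : WeakAssoc Y Y) (hYH : WeakAssoc YH YH) (u v : V)
    (t : V ⊗[ℂ] LaurentSeries ℂ) (k m g h h' : H) :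
    smashPair YVH hr hY hYH u v t k m (g ⊗ₜ (h ⊗ₜ h')) =
      convPair (TensorProduct.mk ℂ V H) (actOpPair YVH hr hY u v t g h) (opPair hYH h' k m) :=
  rfl

theorem cf_tensorOp_cf_laurentTensor (u : V) (g h : H) (a : Laurent V) (b : Laurent H)
    (i j : ℤ) :
    cf i (tensorOp (compAction Y YVH hr u) YH (g ⊗ₜ h) (cf j (laurentTensor a b))) =
      conv (TensorProduct.mk ℂ V H)
        (fun p n => cf p (extendScalars (Y u) (liftAction YVH hr g (cf n a))))
        (fun p n => cf p (YH h (cf n b))) i j := by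
  have h1 := map_finsum (cf i ∘ₗ tensorOp (compAction Y YVH hr u) YH (g ⊗ₜ h))
    (tensor_support_finite a b j)
  rw [cf_laurentTensor]
  refine h1.trans ?_
  rw [conv, ← finsum_comp_equiv (Equiv.prodComm ℤ ℤ), finsum_curry]
  · rfl
  · exact ((convolvable_of_mem
      (mem_iterLaurent_cf (a := a) (extendScalars (Y u) ∘ₗ liftAction YVH hr g))
      (mem_iterLaurent_cf (a := b) (YH h))).finite_support
      (TensorProduct.mk ℂ V H) i j).preimage (Equiv.prodComm ℤ ℤ).injective.injOn

theorem tensorOp_support_finite (w : V) (m : H) (a : Laurent V) (b : Laurent (H ⊗[ℂ] H))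
    (i j : ℤ) :
    (Function.support fun p : ℤ => cf j (tensorOp (compAction Y YVH hr (cf p a)) YH
      (cf (i - p) b) (w ⊗ₜ m))).Finite := by
  obtain ⟨M, hM⟩ := exists_cf_eq_zero a
  obtain ⟨N, hN⟩ := exists_cf_eq_zero b
  refine (Set.finite_Icc M (i - N)).subset fun p hp => ?_
  constructor <;> by_contra hc
  · refine hp ?_
    simp only
    rw [hM p (not_le.mp hc), ← zero_smul ℂ (0 : V), tensorOp_compAction_smul, zero_smul,
      LinearMap.zero_apply, map_zero]
  · refine hp ?_
    simp only
    rw [hN (i - p) (by omega), map_zero, LinearMap.zero_apply, map_zero]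

/-- After `liftAction_cf` the power of `x₀` splits three ways: `p` from `Y(u, x₀)Y(g, x₀)v`, `q`
from `Y(h, x₂ + x₀)` and the rest from `Y(h', x₀)k'`. Grouping the first two gives the product of a
pair for `V` with a pair for `H`. -/
theorem smashPair_tmul_tmul_snd (hY : WeakAssoc Y Y) (hYH : WeakAssoc YH YH)
    (hA : WeakAssoc YH YVH) (u v w : V) (g h h' k k' m : H) (i j : ℤ) :
    ∑ᶠ p : ℤ, cf j (tensorOp (compAction Y YVH hr
        (cf p (extendScalars (Y u) (liftAction YVH hr g v)))) YH
        (cf (i - p) (laurentTensor (YH h k) (YH h' k'))) (w ⊗ₜ m)) =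
      (smashPair YVH hr hY hYH u v (liftAction YVH hr k w) k' m (g ⊗ₜ (h ⊗ₜ h'))).1.2 i j := by
  set a := extendScalars (Y u) (liftAction YVH hr g v) with ha
  obtain ⟨M, hM⟩ := exists_cf_eq_zero a
  obtain ⟨N, hN⟩ := exists_cf_eq_zero (YH h' k')
  let X : ℤ → ℤ → Laurent V := fun p q =>
    extendScalars (Y (cf p a)) (actSeries YVH hr q h (liftAction YVH hr k w))
  let G : ℤ × ℤ → V ⊗[ℂ] H := fun p =>
    cf j (laurentTensor (X p.1 p.2) (YH (cf (i - p.1 - p.2) (YH h' k')) m))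
  have hX : ∀ p q, (p < M ∨ q < 0) → X p q = 0 := by
    rintro p q (h | h)
    · simp only [X, hM p h, map_zero]
      have h0 : extendScalars (0 : HVertexOperator ℤ ℂ V V) = 0 :=
        TensorProduct.ext' fun v f => by simp
      rw [h0, LinearMap.zero_apply]
    · simp only [X, actSeries_of_neg YVH hr h, LinearMap.zero_apply, map_zero]
  have hG : (Function.support G).Finite := by
    refine ((Set.finite_Icc M (i - N)).prod (Set.finite_Icc 0 (i - M - N))).subset ?_
    rintro ⟨p, q⟩ hp
    have h1 : M ≤ p := by
      by_contra hc
      exact hp (by simp only [G]; rw [hX p q (Or.inl (not_le.mp hc))]; simp)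
    have h2 : 0 ≤ q := by
      by_contra hc
      exact hp (by simp only [G]; rw [hX p q (Or.inr (not_le.mp hc))]; simp)
    have h3 : p + q ≤ i - N := by
      by_contra hc
      exact hp (by simp only [G]; rw [hN (i - p - q) (by omega)]; simp)
    exact ⟨⟨h1, by simp only; omega⟩, h2, by simp only; omega⟩
  have h1 : ∀ p : ℤ, cf j (tensorOp (compAction Y YVH hr (cf p a)) YH
      (cf (i - p) (laurentTensor (YH h k) (YH h' k'))) (w ⊗ₜ m)) = ∑ᶠ q, G (p, q) := by
    intro p
    rw [cf_laurentTensor]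
    refine (map_finsum (cf j ∘ₗ (tensorOp (compAction Y YVH hr (cf p a)) YH).flip (w ⊗ₜ m))
      (tensor_support_finite (YH h k) (YH h' k') (i - p))).trans (finsum_congr fun q => ?_)
    change cf j (laurentTensor (extendScalars (Y (cf p a))
      (liftAction YVH hr (cf q (YH h k)) w)) (YH (cf (i - p - q) (YH h' k')) m)) = _
    rw [liftAction_cf YVH hr hA]
  -- The new first index is the total `p + q`, the power of `x₀` carried by the `V` factor.
  let e : ℤ × ℤ ≃ ℤ × ℤ :=
    { toFun p := (p.1 - p.2, p.2)
      invFun p := (p.1 + p.2, p.2)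
      left_inv p := by simp
      right_inv p := by simp }
  rw [finsum_congr h1, ← finsum_curry G hG, ← finsum_comp_equiv e, finsum_curry _
    (hG.preimage e.injective.injOn), smashPair_tmul, convPair_snd, conv, finsum_curry]
  swap
  · exact (convolvable_of_mem_swap (actOpPair YVH hr hY u v (liftAction YVH hr k w) g h).2.2.1
      (opPair hYH h' k' m).2.2.1).finite_support _ i j
  refine finsum_congr fun p => ?_
  have h2 : ∑ᶠ q, G (e (p, q)) = ∑ q ∈ Finset.Icc 0 (p - M), G (e (p, q)) := by
    refine finsum_eq_sum_of_support_subset _ fun q hq => ?_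
    simp only [Finset.coe_Icc]
    constructor <;> by_contra hc
    · exact hq (by simp only [G, e, Equiv.coe_fn_mk]; rw [hX _ _ (Or.inr (not_le.mp hc))]; simp)
    · exact hq (by simp only [G, e, Equiv.coe_fn_mk]; rw [hX _ _ (Or.inl (by omega))]; simp)
  have h3 : ∀ q, G (e (p, q)) =
      cf j (laurentTensor (X (p - q) q) (YH (cf (i - p) (YH h' k')) m)) := by
    intro q
    simp only [G, e, Equiv.coe_fn_mk, show i - (p - q) - q = i - p by ring]
  rw [h2, Finset.sum_congr rfl fun q _ => h3 q, ← map_sum, ← LinearMap.sum_apply, ← map_sum,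
    cf_laurentTensor]
  refine finsum_congr fun n => ?_
  rw [map_sum, ← actOpPair_snd YVH hr hY u v (liftAction YVH hr k w) g h hM]
  rfl

theorem smashPair_tmul_snd (hY : WeakAssoc Y Y) (hYH : WeakAssoc YH YH)
    (hA : WeakAssoc YH YVH) (u v w : V) (g k k' m : H) (y : H ⊗[ℂ] H) (i j : ℤ) :
    ∑ᶠ p : ℤ, cf j (tensorOp (compAction Y YVH hr
        (cf p (extendScalars (Y u) (liftAction YVH hr g v)))) YH
        (cf (i - p) (tensorOp YH YH y (k ⊗ₜ k'))) (w ⊗ₜ m)) =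
      (smashPair YVH hr hY hYH u v (liftAction YVH hr k w) k' m (g ⊗ₜ y)).1.2 i j := by
  induction y with
  | zero => simp
  | add x y hx hy =>
    rw [TensorProduct.tmul_add,
      map_add (smashPair YVH hr hY hYH u v (liftAction YVH hr k w) k' m), Submodule.coe_add,
      Prod.snd_add, Pi.add_apply,
      Pi.add_apply, ← hx, ← hy, ← finsum_add_distrib]
    · exact finsum_congr fun p => by simp
    · exact tensorOp_support_finite YVH hr w m _ _ i j
    · exact tensorOp_support_finite YVH hr w m _ _ i j
  | tmul h h' => exact smashPair_tmul_tmul_snd YVH hr hY hYH hA u v w g h h' k k' m i j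

end SmashAssoc

/-! ### Weak associativity of the smash product. -/

section Smash

variable {V H : Type*} [AddCommGroup V] [Module ℂ V] [AddCommGroup H] [Module ℂ H]
  [Coalgebra ℂ H]
  {YH : H →ₗ[ℂ] VertexOperator ℂ H} {vacH : H} {Y : V →ₗ[ℂ] VertexOperator ℂ V} {vac : V}
  {YVH : H →ₗ[ℂ] VertexOperator ℂ V}
  (hV : IsModuleNonlocalVertexAlgebra YH vacH Y vac YVH)

/-- The left leg of `Δh` must pass `Y(v, x₂)`, which splits it once more; hence `(Δ ⊗ 1)Δh`. -/
theorem smashPair_fst (hH : IsVertexBialgebra YH vacH) (u v : V)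
    (t : V ⊗[ℂ] LaurentSeries ℂ) (h k m : H) (i j : ℤ) :
    cf i (smashY Y YH YVH hV.mem_range (u ⊗ₜ h)
      (cf j (laurentTensor (extendScalars (Y v) t) (YH k m)))) =
    (smashPair YVH hV.mem_range hV.isNonlocalVertexAlgebra.weak_assoc
      hH.isNonlocalVertexAlgebra.weak_assoc u v t k m
      (TensorProduct.assoc ℂ H H H
        (Coalgebra.comul.rTensor H (Coalgebra.comul (R := ℂ) h)))).1.1 i j := by
  obtain ⟨n, ⟨r⟩⟩ := exists_repr_fin h
  have h1 : smashY Y YH YVH hV.mem_range (u ⊗ₜ h) =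
    tensorOp (compAction Y YVH hV.mem_range u) YH (Coalgebra.comul h) := rfl
  rw [h1, ← r.eq]
  simp only [map_sum, LinearMap.sum_apply, LinearMap.rTensor_tmul]
  rw [compatPair.sum_fst]
  refine Finset.sum_congr rfl fun s _ => ?_
  obtain ⟨n', ⟨r'⟩⟩ := exists_repr_fin (r.left s)
  rw [cf_tensorOp_cf_laurentTensor, ← r'.eq, TensorProduct.sum_tmul, map_sum, map_sum]
  simp only [TensorProduct.assoc_tmul, smashPair_tmul]
  rw [← LinearMap.sum_apply, ← map_sum, convPair_fst]
  congr 1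
  ext p q
  rw [compatPair.sum_fst]
  exact cf_extendScalars_liftAction hV u v t r' p q

/-- The outer operator applies `Δ` to `Y(h₂, x₀)k`. As `Δ` is a homomorphism, this splits both `h₂`
and `k`; hence `(1 ⊗ Δ)Δh`. -/
theorem smashPair_snd (hH : IsVertexBialgebra YH vacH) (u v w : V) (h k m : H)
    {ι : Type*} (r : Coalgebra.Repr ℂ k ι) (i j : ℤ) :
    cf j (smashY Y YH YVH hV.mem_range
      (cf i (smashY Y YH YVH hV.mem_range (u ⊗ₜ h) (v ⊗ₜ k))) (w ⊗ₜ m)) =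
    ∑ s ∈ r.index, (smashPair YVH hV.mem_range hV.isNonlocalVertexAlgebra.weak_assoc
      hH.isNonlocalVertexAlgebra.weak_assoc u v (liftAction YVH hV.mem_range (r.left s) w)
      (r.right s) m
      (Coalgebra.comul.lTensor H (Coalgebra.comul (R := ℂ) h))).1.2 i j := by
  obtain ⟨n, ⟨r'⟩⟩ := exists_repr_fin h
  rw [smashY_tmul_tmul Y YH YVH hV.mem_range u v h k r', ← r'.eq]
  simp only [map_sum, LinearMap.sum_apply, compatPair.sum_snd, LinearMap.lTensor_tmul]
  rw [Finset.sum_comm]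
  refine Finset.sum_congr rfl fun s _ => ?_
  simp only [← smashPair_tmul_snd YVH hV.mem_range hV.isNonlocalVertexAlgebra.weak_assoc
    hH.isNonlocalVertexAlgebra.weak_assoc hV.isModule.weak_assoc]
  rw [← finsum_sum_comm _ _ fun s _ => tensorOp_support_finite YVH hV.mem_range w m _ _ i j,
    cf_laurentTensor]
  refine (map_finsum (cf j ∘ₗ (smashY Y YH YVH hV.mem_range).flip (w ⊗ₜ m))
    (tensor_support_finite _ _ i)).trans (finsum_congr fun p => ?_)
  change cf j (tensorOp (compAction Y YVH hV.mem_range _) YH (Coalgebra.comul _) (w ⊗ₜ m)) = _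
  rw [hH.comul_hom.map_op, ← r.eq]
  simp only [map_sum, LinearMap.sum_apply]

theorem smashY_mem_compatPair (hH : IsVertexBialgebra YH vacH) (a b c : V ⊗[ℂ] H) :
    ((fun m n => cf m (smashY Y YH YVH hV.mem_range a
        (cf n (smashY Y YH YVH hV.mem_range b c))),
      fun m n => cf n (smashY Y YH YVH hV.mem_range
        (cf m (smashY Y YH YVH hV.mem_range a b)) c)) :
      (ℤ → ℤ → V ⊗[ℂ] H) × (ℤ → ℤ → V ⊗[ℂ] H)) ∈ compatPair (V ⊗[ℂ] H) := by
  induction a with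
  | zero =>
    convert Submodule.zero_mem (compatPair (V ⊗[ℂ] H)) using 1
    ext <;> simp
  | add x y hx hy =>
    convert Submodule.add_mem _ hx hy using 1
    ext <;> simp
  | tmul u h =>
    induction b with
    | zero =>
      convert Submodule.zero_mem (compatPair (V ⊗[ℂ] H)) using 1
      ext <;> simp
    | add x y hx hy =>
      convert Submodule.add_mem _ hx hy using 1
      ext <;> simp
    | tmul v k =>
      induction c with
      | zero =>
        convert Submodule.zero_mem (compatPair (V ⊗[ℂ] H)) using 1
        ext <;> simp
      | add x y hx hy =>
        convert Submodule.add_mem _ hx hy using 1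
        ext <;> simp
      | tmul w m =>
        obtain ⟨n, ⟨r⟩⟩ := exists_repr_fin k
        -- The two components arise from the two bracketings of the iterated coproduct of `h`;
        -- coassociativity lets one sum of pairs serve for both.
        convert (∑ s ∈ r.index, smashPair YVH hV.mem_range
          hV.isNonlocalVertexAlgebra.weak_assoc hH.isNonlocalVertexAlgebra.weak_assoc u v
          (liftAction YVH hV.mem_range (r.left s) w) (r.right s) m
          (Coalgebra.comul.lTensor H (Coalgebra.comul (R := ℂ) h))).2 using 1
        refine Prod.ext ?_ ?_
        · ext i j
          rw [compatPair.sum_fst, smashY_tmul_tmul Y YH YVH hV.mem_range v w k m r]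
          simp only [map_sum, smashPair_fst hV hH, Coalgebra.coassoc_apply]
        · ext i j
          rw [compatPair.sum_snd]
          exact smashPair_snd hV hH u v w h k m r i j

theorem smashY_weakAssoc (hH : IsVertexBialgebra YH vacH) :
    WeakAssoc (smashY Y YH YVH hV.mem_range) (smashY Y YH YVH hV.mem_range) := by
  intro a b c
  obtain ⟨-, -, l, hl⟩ := smashY_mem_compatPair hV hH a b c
  refine ⟨l, fun i j => ?_⟩
  rw [mulAddPow_eq, mulAddPow_eq]
  exact congrFun (congrFun hl i) j

end Smash

/-! ### Tensoring the twisted sums with `H`. -/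

section TensorSeries

variable {V H : Type*} [AddCommGroup V] [Module ℂ V] [AddCommGroup H] [Module ℂ H]

/-- A functional `f` with `f v ≠ 0` recovers `k` from `v ⊗ k` up to the nonzero factor `f v`. -/
theorem tmul_left_injective {v : V} (hv : v ≠ 0) :
    Function.Injective (TensorProduct.mk ℂ V H v) := by
  obtain ⟨f, hf⟩ : ∃ f : Module.Dual ℂ V, f v ≠ 0 := by
    by_contra! h
    exact hv ((Module.forall_dual_apply_eq_zero_iff ℂ v).mp h)
  intro h k e
  have h1 := congrArg ((TensorProduct.lid ℂ H).toLinearMap ∘ₗ LinearMap.rTensor H f) e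
  exact smul_right_injective H hf (by simpa using h1)

theorem cf_laurentTensor_const (a : Laurent V) (k : H) (n : ℤ) :
    cf n (laurentTensor a (constLaurent k)) = cf n a ⊗ₜ[ℂ] k := by
  rw [cf_laurentTensor, finsum_eq_single _ n]
  · simp [cf_constLaurent]
  · intro i hi
    rw [cf_constLaurent, if_neg (by omega), TensorProduct.tmul_zero]

theorem cf_const_laurentTensor (v : V) (b : Laurent H) (n : ℤ) :
    cf n (laurentTensor (constLaurent v) b) = v ⊗ₜ[ℂ] cf n b := by
  rw [cf_laurentTensor, finsum_eq_single _ 0]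
  · simp [cf_constLaurent]
  · intro i hi
    rw [cf_constLaurent, if_neg hi, TensorProduct.zero_tmul]

theorem tensorEmb_tmul_one (v : V) :
    tensorEmb V (v ⊗ₜ (1 : LaurentSeries ℂ)) = constLaurent v := by
  refine cf_ext fun n => ?_
  rw [cf_tensorEmb_tmul, cf_constLaurent, HahnSeries.coeff_one]
  split_ifs <;> simp

theorem extendScalars_tmul_one {W : Type*} [AddCommGroup W] [Module ℂ W]
    (A : HVertexOperator ℤ ℂ V W) (v : V) :
    extendScalars A (v ⊗ₜ (1 : LaurentSeries ℂ)) = A v := one_smul (LaurentSeries ℂ) (A v)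

theorem twistedSum_support_finite {Y : V →ₗ[ℂ] VertexOperator ℂ V} {a b : Laurent V}
    (h : BoundedBelow Y a b) (c : Laurent H) (i j : ℤ) :
    (Function.support fun p : (ℤ × ℕ) × ℤ =>
      twistedTerm Y a b p.2 j p.1 ⊗ₜ[ℂ] cf (i - p.2) c).Finite := by
  obtain ⟨N, hN⟩ := h
  obtain ⟨A, hA⟩ := exists_cf_eq_zero a
  obtain ⟨B, hB⟩ := exists_cf_eq_zero b
  obtain ⟨C, hC⟩ := exists_cf_eq_zero c
  refine (((Set.finite_Icc A (i - C + (j - N).toNat - B)).prod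
    (Set.finite_Iic (j - N).toNat)).prod (Set.finite_Icc (A - (j - N).toNat + B) (i - C))).subset ?_
  rintro ⟨⟨n, k⟩, q⟩ hp
  have hk : k ≤ (j - N).toNat := by
    by_contra hc
    exact hp (by simp only [twistedTerm]; rw [hN _ (by omega), smul_zero, TensorProduct.zero_tmul])
  have hn : A ≤ n := by
    by_contra hc
    exact hp (by simp only [twistedTerm]; rw [hA _ (not_le.mp hc)]; simp)
  have hq : q ≤ i - C := by
    by_contra hc
    exact hp (by simp only; rw [hC _ (by omega), TensorProduct.tmul_zero])
  have hb : B ≤ q - n + k := by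
    by_contra hc
    exact hp (by simp only [twistedTerm]; rw [hB _ (not_le.mp hc)]; simp)
  exact ⟨⟨⟨hn, by simp only; omega⟩, hk⟩, by simp only; omega, hq⟩

theorem twistedCoeff_support_finite {Y : V →ₗ[ℂ] VertexOperator ℂ V} {a b : Laurent V}
    (h : BoundedBelow Y a b) (c : Laurent H) (i j : ℤ) :
    (Function.support fun q : ℤ => twistedCoeff Y a b q j ⊗ₜ[ℂ] cf (i - q) c).Finite := by
  refine ((twistedSum_support_finite h c i j).image Prod.snd).subset fun q hq => ?_
  by_contra hc
  refine hq ?_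
  have h1 : ∀ p, twistedTerm Y a b q j p ⊗ₜ[ℂ] cf (i - q) c = 0 := fun p => by
    by_contra h0
    exact hc ⟨(p, q), h0, rfl⟩
  change (TensorProduct.mk ℂ V H).flip (cf (i - q) c) (twistedCoeff Y a b q j) = 0
  rw [twistedCoeff, map_finsum _ (h.support_finite q j)]
  exact (finsum_congr h1).trans finsum_zero

variable {Y : V →ₗ[ℂ] VertexOperator ℂ V} {Z : V →ₗ[ℂ] VertexOperator ℂ (V ⊗[ℂ] H)}

theorem cf_apply_cf_laurentTensor (u : V) (b : Laurent V) (c : Laurent H) (m n : ℤ)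
    (hZ : ∀ u v k, Z u (v ⊗ₜ k) = laurentTensor (Y u v) (constLaurent k)) :
    cf m (Z u (cf n (laurentTensor b c))) =
      ∑ᶠ q : ℤ, cf m (Y u (cf q b)) ⊗ₜ[ℂ] cf (n - q) c := by
  rw [cf_laurentTensor]
  refine (map_finsum (cf m ∘ₗ Z u) (tensor_support_finite b c n)).trans
    (finsum_congr fun q => ?_)
  simp only [LinearMap.comp_apply]
  rw [hZ, cf_laurentTensor_const]

theorem BoundedBelow.laurentTensor {a b : Laurent V} (h : BoundedBelow Y a b) (c : Laurent H)
    (hZ : ∀ u v k, Z u (v ⊗ₜ k) = laurentTensor (Y u v) (constLaurent k)) :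
    BoundedBelow Z a (laurentTensor b c) := by
  obtain ⟨N, hN⟩ := h
  refine ⟨N, fun m hm n n' => ?_⟩
  rw [cf_apply_cf_laurentTensor _ _ _ _ _ hZ]
  exact (finsum_congr fun q => by rw [hN m hm, TensorProduct.zero_tmul]).trans finsum_zero

/-- Since `Z` acts as `Y ⊗ 1`, the factor `c(x₁)` only multiplies. The point is the interchange of
two infinite sums, justified by the joint finiteness of `twistedSum_support_finite`. -/
theorem twistedCoeff_laurentTensor {a b : Laurent V} (h : BoundedBelow Y a b) (c : Laurent H)
    (hZ : ∀ u v k, Z u (v ⊗ₜ k) = laurentTensor (Y u v) (constLaurent k)) (i j : ℤ) :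
    twistedCoeff Z a (laurentTensor b c) i j =
      ∑ᶠ q : ℤ, twistedCoeff Y a b q j ⊗ₜ[ℂ] cf (i - q) c := by
  have hfin := twistedSum_support_finite h c i j
  have h1 : ∀ q : ℤ, twistedCoeff Y a b q j ⊗ₜ[ℂ] cf (i - q) c =
      ∑ᶠ p : ℤ × ℕ, twistedTerm Y a b q j p ⊗ₜ[ℂ] cf (i - q) c := fun q =>
    map_finsum ((TensorProduct.mk ℂ V H).flip (cf (i - q) c)) (h.support_finite q j)
  have h2 : ∀ p : ℤ × ℕ, twistedTerm Z a (laurentTensor b c) i j p =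
      ∑ᶠ q : ℤ, twistedTerm Y a b q j p ⊗ₜ[ℂ] cf (i - q) c := by
    intro p
    rw [twistedTerm, cf_apply_cf_laurentTensor _ _ _ _ _ hZ,
      -- The shift replaces the exponent in `b` by the total exponent of `x₁` in the `V` factor,
      -- which does not depend on `p`.
      ← finsum_comp_equiv (Equiv.addRight (-p.1 + (p.2 : ℤ)))]
    have h3 : ∀ q : ℤ, i - p.1 + p.2 - (q + (-p.1 + p.2)) = i - q := fun q => by ring
    simp only [Equiv.coe_addRight, h3]
    rw [← Int.cast_smul_eq_zsmul ℂ, smul_finsum]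
    refine finsum_congr fun q => ?_
    rw [twistedTerm, Int.cast_smul_eq_zsmul, TensorProduct.smul_tmul', ← add_assoc,
      ← sub_eq_add_neg]
  rw [twistedCoeff, finsum_congr h1, finsum_congr h2, ← finsum_curry _ hfin,
    ← finsum_comp_equiv (Equiv.prodComm ℤ (ℤ × ℕ)), finsum_curry]
  · rfl
  · exact hfin.preimage (Equiv.prodComm ℤ (ℤ × ℕ)).injective.injOn

theorem boundedBelow_tensorOp {YH : H →ₗ[ℂ] VertexOperator ℂ H}
    {YVH : H →ₗ[ℂ] VertexOperator ℂ V}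
    (hr : ∀ (h : H) (v : V), YVH h v ∈ LinearMap.range (tensorEmb V))
    (hZ : ∀ u v k, Z u (v ⊗ₜ k) = laurentTensor (Y u v) (constLaurent k))
    (g : H) (u v : V) (k : H) (y : H ⊗[ℂ] H) :
    BoundedBelow Z (YVH g u) (tensorOp YVH YH y (v ⊗ₜ k)) := by
  induction y with
  | zero => rw [map_zero, LinearMap.zero_apply]; exact BoundedBelow.zero_right _
  | add x y hx hy => rw [map_add, LinearMap.add_apply]; exact hx.add_right hy
  | tmul h h' =>
    rw [tensorOp_tmul_tmul, ← tensorEmb_liftAction YVH hr, ← tensorEmb_liftAction YVH hr h v]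
    exact (boundedBelow_tensorEmb _ _).laurentTensor _ hZ

/-- The coefficient of `x₁ ^ i x₂ ^ j` of
`Y(Y(g, x₁ - x₂) u, x₂) Y(h, x₁) v ⊗ Y(h', x₁) k` at `g ⊗ (h ⊗ h')`. -/
def twistedTensor (YH : H →ₗ[ℂ] VertexOperator ℂ H) (YVH : H →ₗ[ℂ] VertexOperator ℂ V)
    (hr : ∀ (h : H) (v : V), YVH h v ∈ LinearMap.range (tensorEmb V))
    (hZ : ∀ u v k, Z u (v ⊗ₜ k) = laurentTensor (Y u v) (constLaurent k))
    (u v : V) (k : H) (i j : ℤ) : H ⊗[ℂ] (H ⊗[ℂ] H) →ₗ[ℂ] V ⊗[ℂ] H :=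
  TensorProduct.lift (LinearMap.mk₂ ℂ
    (fun g y => twistedCoeff Z (YVH g u) (tensorOp YVH YH y (v ⊗ₜ k)) i j)
    (fun g g' y => by
      rw [map_add, LinearMap.add_apply]
      exact twistedCoeff_add_left (boundedBelow_tensorOp hr hZ g u v k y)
        (boundedBelow_tensorOp hr hZ g' u v k y) i j)
    (fun c g y => by
      rw [map_smul, LinearMap.smul_apply, twistedCoeff_smul_left])
    (fun g y y' => by
      rw [map_add, LinearMap.add_apply]
      exact twistedCoeff_add_right (boundedBelow_tensorOp hr hZ g u v k y)
        (boundedBelow_tensorOp hr hZ g u v k y') i j)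
    (fun c g y => by
      rw [map_smul, LinearMap.smul_apply, twistedCoeff_smul_right]))

theorem twistedTensor_tmul (YH : H →ₗ[ℂ] VertexOperator ℂ H) (YVH : H →ₗ[ℂ] VertexOperator ℂ V)
    (hr : ∀ (h : H) (v : V), YVH h v ∈ LinearMap.range (tensorEmb V))
    (hZ : ∀ u v k, Z u (v ⊗ₜ k) = laurentTensor (Y u v) (constLaurent k))
    (u v : V) (k : H) (i j : ℤ) (g : H) (y : H ⊗[ℂ] H) :
    twistedTensor YH YVH hr hZ u v k i j (g ⊗ₜ y) =
      twistedCoeff Z (YVH g u) (tensorOp YVH YH y (v ⊗ₜ k)) i j := rfl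

end TensorSeries

/-! ### Vacuum axioms, subalgebras and twisted commutation. -/

section SmashProduct

variable {V H : Type*} [AddCommGroup V] [Module ℂ V] [AddCommGroup H] [Module ℂ H]
  [Coalgebra ℂ H]
  {YH : H →ₗ[ℂ] VertexOperator ℂ H} {vacH : H} {Y : V →ₗ[ℂ] VertexOperator ℂ V} {vac : V}
  {YVH : H →ₗ[ℂ] VertexOperator ℂ V}
  (hV : IsModuleNonlocalVertexAlgebra YH vacH Y vac YVH)

theorem sum_counit_smul_map {M ι : Type*} [AddCommGroup M] [Module ℂ M] (f : H →ₗ[ℂ] M) {h : H}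
    (r : Coalgebra.Repr ℂ h ι) :
    ∑ s ∈ r.index, Coalgebra.counit (R := ℂ) (r.left s) • f (r.right s) = f h := by
  conv_rhs => rw [← Coalgebra.sum_counit_smul r]
  simp only [map_sum, map_smul]

theorem compAction_vac : compAction Y YVH hV.mem_range vac = YVH := by
  have h : Y vac = constLaurent := LinearMap.ext hV.isNonlocalVertexAlgebra.vacuum
  refine LinearMap.ext₂ fun g v => ?_
  change extendScalars (Y vac) (liftAction YVH hV.mem_range g v) = YVH g v
  rw [h]
  exact tensorEmb_liftAction YVH hV.mem_range g v

theorem smashY_vac_tmul (h : H) :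
    smashY Y YH YVH hV.mem_range (vac ⊗ₜ h) = tensorOp YVH YH (Coalgebra.comul h) := by
  change tensorOp (compAction Y YVH hV.mem_range vac) YH (Coalgebra.comul h) = _
  rw [compAction_vac hV]

theorem smashY_tmul_vac (hH : IsVertexBialgebra YH vacH) (u v : V) (k : H) :
    smashY Y YH YVH hV.mem_range (u ⊗ₜ vacH) (v ⊗ₜ k) =
      laurentTensor (Y u v) (constLaurent k) := by
  have h : liftAction YVH hV.mem_range vacH v = v ⊗ₜ 1 := tensorEmb_injective (by
    rw [tensorEmb_liftAction, tensorEmb_tmul_one, hV.isModule.vacuum])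
  change tensorOp (compAction Y YVH hV.mem_range u) YH (Coalgebra.comul vacH) (v ⊗ₜ k) = _
  rw [hH.comul_hom.map_vac, tensorOp_tmul_tmul, hH.isNonlocalVertexAlgebra.vacuum]
  change laurentTensor (extendScalars (Y u) (liftAction YVH hV.mem_range vacH v)) _ = _
  rw [h, extendScalars_tmul_one]

/-- The left leg acts on the vacuum of `V` by `ε(h₁)`, and the counit identity collapses the sum to
`h`. -/
theorem smashY_vac_tmul_vac_tmul (h k : H) :
    smashY Y YH YVH hV.mem_range (vac ⊗ₜ h) (vac ⊗ₜ k) =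
      laurentTensor (constLaurent vac) (YH h k) := by
  obtain ⟨n, ⟨r⟩⟩ := exists_repr_fin h
  rw [smashY_vac_tmul hV, ← r.eq, map_sum, LinearMap.sum_apply]
  simp only [tensorOp_tmul_tmul, hV.act_vac, map_smul, LinearMap.smul_apply]
  exact sum_counit_smul_map (laurentTensor (constLaurent vac) ∘ₗ YH.flip k) r

theorem smashY_tmul_vac_tmul_vac (u : V) (h : H) :
    smashY Y YH YVH hV.mem_range (u ⊗ₜ h) (vac ⊗ₜ vacH) =
      laurentTensor (Y u vac) (YH h vacH) := by
  obtain ⟨n, ⟨r⟩⟩ := exists_repr_fin h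
  have h1 : ∀ g : H, liftAction YVH hV.mem_range g vac =
      (Coalgebra.counit (R := ℂ) g • vac) ⊗ₜ 1 := fun g => tensorEmb_injective (by
    rw [tensorEmb_liftAction, tensorEmb_tmul_one, hV.act_vac])
  rw [smashY_tmul_tmul Y YH YVH hV.mem_range u vac h vacH r]
  simp only [h1, extendScalars_tmul_one, map_smul, LinearMap.smul_apply]
  exact sum_counit_smul_map (laurentTensor (Y u vac) ∘ₗ YH.flip vacH) r

theorem isNonlocalVertexAlgebra_smashY (hH : IsVertexBialgebra YH vacH) :
    IsNonlocalVertexAlgebra (smashY Y YH YVH hV.mem_range) (vac ⊗ₜ[ℂ] vacH) where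
  vacuum w := by
    induction w with
    | zero => simp
    | add x y hx hy => rw [map_add, map_add, hx, hy]
    | tmul v k =>
      rw [smashY_tmul_vac hV hH, hV.isNonlocalVertexAlgebra.vacuum]
      refine cf_ext fun n => ?_
      rw [cf_laurentTensor_const, cf_constLaurent, cf_constLaurent]
      split_ifs <;> simp
  regular w n hn := by
    induction w with
    | zero => simp
    | add x y hx hy => rw [map_add, LinearMap.add_apply, map_add, hx, hy, add_zero]
    | tmul u h =>
      rw [smashY_tmul_vac_tmul_vac hV, cf_laurentTensor]
      refine (finsum_congr fun q => ?_).trans finsum_zero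
      rcases lt_or_ge q 0 with hq | hq
      · rw [hV.isNonlocalVertexAlgebra.regular u q hq, TensorProduct.zero_tmul]
      · rw [hH.isNonlocalVertexAlgebra.regular h (n - q) (by omega), TensorProduct.tmul_zero]
  creation w := by
    induction w with
    | zero => simp
    | add x y hx hy => rw [map_add, LinearMap.add_apply, map_add, hx, hy]
    | tmul u h =>
      rw [smashY_tmul_vac_tmul_vac hV, cf_laurentTensor, finsum_eq_single _ 0]
      · rw [sub_zero, hV.isNonlocalVertexAlgebra.creation, hH.isNonlocalVertexAlgebra.creation]
      · intro q hq
        rcases lt_or_gt_of_ne hq with hq | hq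
        · rw [hV.isNonlocalVertexAlgebra.regular u q hq, TensorProduct.zero_tmul]
        · rw [hH.isNonlocalVertexAlgebra.regular h (0 - q) (by omega), TensorProduct.tmul_zero]
  weak_assoc := smashY_weakAssoc hV hH

theorem isHom_tmul_vac (hH : IsVertexBialgebra YH vacH) :
    IsHom Y vac (smashY Y YH YVH hV.mem_range) (vac ⊗ₜ[ℂ] vacH)
      ((TensorProduct.mk ℂ V H).flip vacH) where
  map_vac := rfl
  map_op u v n := by
    simp only [LinearMap.flip_apply, TensorProduct.mk_apply]
    rw [smashY_tmul_vac hV hH, cf_laurentTensor_const]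

/-- Since `ε` maps the vacuum to `1`, the map `id ⊗ ε` is a left inverse. -/
theorem tmul_vac_injective (hH : IsVertexBialgebra YH vacH) :
    Function.Injective ((TensorProduct.mk ℂ V H).flip vacH) := by
  intro u v h
  have h1 := congrArg
    ((TensorProduct.rid ℂ V).toLinearMap ∘ₗ
      LinearMap.lTensor V (Coalgebra.counit (R := ℂ) (A := H))) h
  simpa [hH.counit_hom.map_vac] using h1

theorem isHom_vac_tmul :
    IsHom YH vacH (smashY Y YH YVH hV.mem_range) (vac ⊗ₜ[ℂ] vacH)
      (TensorProduct.mk ℂ V H vac) where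
  map_vac := rfl
  map_op h k n := by
    simp only [TensorProduct.mk_apply]
    rw [smashY_vac_tmul_vac_tmul hV, cf_const_laurentTensor]

theorem IsNonlocalVertexAlgebra.vac_ne_zero [Nontrivial V] (h : IsNonlocalVertexAlgebra Y vac) :
    vac ≠ 0 := by
  rintro rfl
  obtain ⟨v, hv⟩ := exists_ne (0 : V)
  have h1 := congrArg (cf 0) (h.vacuum v)
  rw [cf_constLaurent, if_pos rfl] at h1
  exact hv (by simpa using h1.symm)

theorem smashY_comp_flip_mk (hH : IsVertexBialgebra YH vacH) (u v : V) (k : H) :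
    (smashY Y YH YVH hV.mem_range ∘ₗ (TensorProduct.mk ℂ V H).flip vacH) u (v ⊗ₜ k) =
      laurentTensor (Y u v) (constLaurent k) := smashY_tmul_vac hV hH u v k

/-- Moving the left leg of `Δh` past `Y(u, x₂)` yields `(Δ ⊗ 1)Δh`. Coassociativity rewrites it as
`(1 ⊗ Δ)Δh`, the form in which the right-hand side of the commutation relation arises. -/
theorem smashY_vac_tmul_cf_smashY_tmul_vac (hH : IsVertexBialgebra YH vacH) (h : H) (u v : V)
    (k : H) (i j : ℤ) :
    cf i (smashY Y YH YVH hV.mem_range (vac ⊗ₜ h)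
      (cf j (smashY Y YH YVH hV.mem_range (u ⊗ₜ vacH) (v ⊗ₜ k)))) =
    twistedTensor (Z := smashY Y YH YVH hV.mem_range ∘ₗ (TensorProduct.mk ℂ V H).flip vacH)
      YH YVH hV.mem_range (smashY_comp_flip_mk hV hH) u v k i j
      (Coalgebra.comul.lTensor H (Coalgebra.comul (R := ℂ) h)) := by
  obtain ⟨n, ⟨r⟩⟩ := exists_repr_fin h
  rw [smashY_tmul_vac hV hH, cf_laurentTensor_const, ← Coalgebra.coassoc_apply,
    smashY_vac_tmul hV,
    ← r.eq]
  simp only [map_sum, LinearMap.sum_apply, LinearMap.rTensor_tmul, tensorOp_tmul_tmul]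
  refine Finset.sum_congr rfl fun s _ => ?_
  obtain ⟨n', ⟨r'⟩⟩ := exists_repr_fin (r.left s)
  rw [← r'.eq, TensorProduct.sum_tmul, map_sum, map_sum, cf_laurentTensor]
  simp only [TensorProduct.assoc_tmul, twistedTensor_tmul, tensorOp_tmul_tmul]
  have hb : ∀ s', BoundedBelow Y (YVH (r'.left s') u) (YVH (r'.right s') v) := fun s' => by
    rw [← tensorEmb_liftAction YVH hV.mem_range, ← tensorEmb_liftAction YVH hV.mem_range _ v]
    exact boundedBelow_tensorEmb _ _
  simp only [twistedCoeff_laurentTensor (hb _) _ (smashY_comp_flip_mk hV hH)]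
  rw [← finsum_sum_comm _ _ fun s' _ => twistedCoeff_support_finite (hb s') _ i j]
  refine finsum_congr fun q => ?_
  rw [hV.act_op _ _ _ r', TensorProduct.sum_tmul]

/-- The truncation bound is proved together with the identity because the twisted sum is shown
additive in `w` only under that bound. On pure tensors, linearity of `twistedTensor` allows any
representation of `Δh`. -/
theorem twisted_commutation (hH : IsVertexBialgebra YH vacH) (h : H) (u : V) (w : V ⊗[ℂ] H)
    {ι : Type*} (r : Coalgebra.Repr ℂ h ι) :
    (∀ s, BoundedBelow (smashY Y YH YVH hV.mem_range ∘ₗ (TensorProduct.mk ℂ V H).flip vacH)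
      (YVH (r.left s) u) (smashY Y YH YVH hV.mem_range (vac ⊗ₜ[ℂ] r.right s) w)) ∧
    ∀ i j, cf i (smashY Y YH YVH hV.mem_range (vac ⊗ₜ[ℂ] h)
        (cf j (smashY Y YH YVH hV.mem_range (u ⊗ₜ[ℂ] vacH) w))) =
      ∑ s ∈ r.index, twistedCoeff
        (smashY Y YH YVH hV.mem_range ∘ₗ (TensorProduct.mk ℂ V H).flip vacH)
        (YVH (r.left s) u)
        (smashY Y YH YVH hV.mem_range (vac ⊗ₜ[ℂ] r.right s) w) i j := by
  induction w with
  | zero =>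
    refine ⟨fun s => ?_, fun i j => ?_⟩
    · rw [map_zero]
      exact BoundedBelow.zero_right _
    · simp [twistedCoeff_zero_right]
  | add x y hx hy =>
    refine ⟨fun s => ?_, fun i j => ?_⟩
    · rw [map_add]
      exact (hx.1 s).add_right (hy.1 s)
    · simp only [map_add]
      rw [hx.2, hy.2, ← Finset.sum_add_distrib]
      exact Finset.sum_congr rfl fun s _ => (twistedCoeff_add_right (hx.1 s) (hy.1 s) i j).symm
  | tmul v k =>
    refine ⟨fun s => ?_, fun i j => ?_⟩
    · rw [smashY_vac_tmul hV]
      exact boundedBelow_tensorOp hV.mem_range (smashY_comp_flip_mk hV hH) _ u v k _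
    · rw [smashY_vac_tmul_cf_smashY_tmul_vac hV hH, ← r.eq]
      simp only [map_sum, LinearMap.lTensor_tmul, twistedTensor_tmul, smashY_vac_tmul hV]

end SmashProduct

end NonlocalVA

end

theorem theorem4p9 {V : Type*} {H : Type*} [AddCommGroup V] [Module ℂ V] [AddCommGroup H]
    [Module ℂ H] [Coalgebra ℂ H] (YH : H →ₗ[ℂ] VertexOperator ℂ H) (vacH : H)
    (hH : IsVertexBialgebra YH vacH) (Y : V →ₗ[ℂ] VertexOperator ℂ V) (vac : V)
    (YVH : H →ₗ[ℂ] VertexOperator ℂ V)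
    (hV : IsModuleNonlocalVertexAlgebra YH vacH Y vac YVH) :
    -- the smash product is a nonlocal vertex algebra
    IsNonlocalVertexAlgebra (smashY Y YH YVH hV.mem_range) (vac ⊗ₜ[ℂ] vacH) ∧
    -- `u ↦ u ⊗ 1` embeds `V` as a subalgebra
    (IsHom Y vac (smashY Y YH YVH hV.mem_range) (vac ⊗ₜ[ℂ] vacH)
        ((TensorProduct.mk ℂ V H).flip vacH) ∧
      Function.Injective ((TensorProduct.mk ℂ V H).flip vacH)) ∧
    -- `h ↦ 1 ⊗ h` is a homomorphism, and embeds `H` as a subalgebra unless `V = 0`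
    (IsHom YH vacH (smashY Y YH YVH hV.mem_range) (vac ⊗ₜ[ℂ] vacH) (TensorProduct.mk ℂ V H vac) ∧
      (Nontrivial V → Function.Injective (TensorProduct.mk ℂ V H vac))) ∧
    -- the twisted commutation relation, coefficientwise on every vector of `V ⊗ H`; the infinite
    -- sums that define the coefficients of the right-hand side have finite support
    (∀ (h : H) (u : V) (w : V ⊗[ℂ] H) {ι : Type*} (r : Coalgebra.Repr ℂ h ι) (i j : ℤ),
      (∀ s ∈ r.index, (Function.support (twistedTerm
        (smashY Y YH YVH hV.mem_range ∘ₗ (TensorProduct.mk ℂ V H).flip vacH)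
        (YVH (r.left s) u)
        (smashY Y YH YVH hV.mem_range (vac ⊗ₜ[ℂ] r.right s) w) i j)).Finite) ∧
      cf i (smashY Y YH YVH hV.mem_range (vac ⊗ₜ[ℂ] h)
          (cf j (smashY Y YH YVH hV.mem_range (u ⊗ₜ[ℂ] vacH) w))) =
        ∑ s ∈ r.index, twistedCoeff
          (smashY Y YH YVH hV.mem_range ∘ₗ (TensorProduct.mk ℂ V H).flip vacH)
          (YVH (r.left s) u)
          (smashY Y YH YVH hV.mem_range (vac ⊗ₜ[ℂ] r.right s) w) i j) := by
  exact ⟨isNonlocalVertexAlgebra_smashY hV hH, ⟨isHom_tmul_vac hV hH, tmul_vac_injective hH⟩,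
    ⟨isHom_vac_tmul hV, fun _ => tmul_left_injective
      hV.isNonlocalVertexAlgebra.vac_ne_zero⟩,
    fun h u w _ r i j => ⟨fun s _ => ((twisted_commutation hV hH h u w r).1 s).support_finite i j,
      (twisted_commutation hV hH h u w r).2 i j⟩⟩
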